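/- For a Borel set $E\subset\mathbb R^n$ let $|E|$ denote its Lebesgue measure, and let $$P(E):=\sup\left\{\int_E \operatorname{div}X\,\mathrm{d}x \;:\; X\in C^\infty_c(\mathbb R^n;\mathbb R^n),\ |X|\le 1\right\}\in[0,\infty]$$ be its perimeter; $E$ has finite perimeter if $P(E)<\infty$. Write $B_1(p)$ for the open unit ball centered at $p$. Theorem (Euclidean isoperimetric inequality). Let $E\subset\mathbb R^n$ be a Borel set of finite perimeter with $|E|=|B_1(0)|=\omega_n$, where $\omega_n$ is the volume of the unit ball of $\mathbb R^n$. Then $$P(E)\ge P(B_1(0)).$$ If equality holds, then there is $p\in\mathbb R^n$ such that $|E\,\Delta\, B_1(p)|=0$, where $\Delta$ is the symmetric difference. -/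

import Mathlib

open MeasureTheory Set

open scoped ContDiff

/-- The divergence `∑ i, ∂ᵢ Xᵢ` of a vector field on `ℝⁿ`. -/
noncomputable def divergence {n : ℕ}
    (X : EuclideanSpace ℝ (Fin n) → EuclideanSpace ℝ (Fin n))
    (x : EuclideanSpace ℝ (Fin n)) : ℝ :=
  ∑ i : Fin n, (fderiv ℝ X x (EuclideanSpace.single i 1)) i

/-- The fields competing in the definition of the perimeter: smooth vector fields on `ℝⁿ` with
compact support contained in `Ω` and Euclidean length at most `1` at every point. -/
structure IsTestField {n : ℕ} (Ω : Set (EuclideanSpace ℝ (Fin n)))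
    (X : EuclideanSpace ℝ (Fin n) → EuclideanSpace ℝ (Fin n)) : Prop where
  contDiff : ContDiff ℝ ∞ X
  hasCompactSupport : HasCompactSupport X
  tsupport_subset : tsupport X ⊆ Ω
  norm_le_one : ∀ x, ‖X x‖ ≤ 1

/-- The perimeter `P(E, Ω)` of `E` inside an open set `Ω`: the supremum of `∫_E div X` over all
test fields. The field `X = 0` competes, so the supremum is nonnegative and cutting the
negative values off by `ENNReal.ofReal` does not change it. -/
noncomputable def perimeterIn {n : ℕ} (E Ω : Set (EuclideanSpace ℝ (Fin n))) : ENNReal :=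
  ⨆ (X : EuclideanSpace ℝ (Fin n) → EuclideanSpace ℝ (Fin n)) (_ : IsTestField Ω X),
    ENNReal.ofReal (∫ x in E, divergence X x)

/-- The perimeter `P(E) = P(E, ℝⁿ)`. -/
noncomputable def perimeter {n : ℕ} (E : Set (EuclideanSpace ℝ (Fin n))) : ENNReal :=
  perimeterIn E univ

/-- A Borel set `E ⊆ ℝⁿ` has finite perimeter if `P(E) < ∞`. -/
structure HasFinitePerimeter {n : ℕ} (E : Set (EuclideanSpace ℝ (Fin n))) : Prop where
  measurableSet : MeasurableSet E
  perimeter_lt_top : perimeter E < ⊤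

open Filter Topology ProbabilityTheory

open scoped Convolution Pointwise InnerProductSpace

/-! The inequality is Gromov's argument with the Knothe map. Rearranging one coordinate at a time
carries the uniform measure of E to that of the unit ball by a map X into the closed unit ball,
triangular, with each component nondecreasing in its own variable. The product of the diagonal
derivatives is |B|/|E| a.e. on E, so by AM-GM their sum is at least N(|B|/|E|)^(1/N), N being the
dimension. As |X| ≤ 1, integrating this formal divergence over E gives at most P(E). In place of
differentiability of X, lower partial derivatives (liminf of difference quotients) are used;
mollification, Lebesgue points and Fatou give exactly the needed one-sided bound
`lintegral_sum_lowerPartial_le_perimeter`. The construction is `exists_knothe`, and radial cutoffs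
give P(B) ≤ N|B| for the ball.

For equality, AM-GM forces the first diagonal derivative to be 1 on E, so the rearrangement T of the
first marginals has slope 1 wherever the slice of E is not null. There could still be gaps. If the
distribution function F of the first coordinate had F' = 0 at a height with 0 < F < 1, cutting E
there would not increase the perimeter (`perimeter_add_perimeter_le`), while each piece, having
smaller volume, satisfies the strict bound P > N·volume; this is a contradiction. Hence T is a
translation, and the first marginal of E is a translate of that of the ball.

The hypotheses are invariant under linear isometries, so the marginals in all directions are
translates of those of the ball. The barycentre p of E identifies all the translations at once, and
characteristic functions (Cramér-Wold) identify the uniform measure on E with that on the unit ball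
at p. -/

/-! ### Test fields without compact support -/

theorem le_perimeter_of_isTestField {n : ℕ} (E : Set (EuclideanSpace ℝ (Fin n)))
    {X : EuclideanSpace ℝ (Fin n) → EuclideanSpace ℝ (Fin n)} (hX : IsTestField univ X) :
    ENNReal.ofReal (∫ x in E, divergence X x) ≤ perimeter E :=
  le_iSup₂ (f := fun (X : EuclideanSpace ℝ (Fin n) → EuclideanSpace ℝ (Fin n))
    (_ : IsTestField univ X) => ENNReal.ofReal (∫ x in E, divergence X x)) X hX

theorem divergence_smul {n : ℕ} {f : EuclideanSpace ℝ (Fin n) → ℝ}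
    {X : EuclideanSpace ℝ (Fin n) → EuclideanSpace ℝ (Fin n)} {x : EuclideanSpace ℝ (Fin n)}
    (hf : DifferentiableAt ℝ f x) (hX : DifferentiableAt ℝ X x) :
    divergence (fun y => f y • X y) x = f x * divergence X x + fderiv ℝ f x (X x) := by
  have h := (hf.hasFDerivAt.smul hX.hasFDerivAt).fderiv
  unfold divergence
  have h' : fderiv ℝ (fun y => f y • X y) x =
    f x • fderiv ℝ X x + ContinuousLinearMap.smulRight (fderiv ℝ f x) (X x) := h
  rw [h']
  simp only [add_apply, smul_apply,
    ContinuousLinearMap.smulRight_apply, PiLp.add_apply, PiLp.smul_apply, smul_eq_mul,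
    Finset.sum_add_distrib, ← Finset.mul_sum]
  congr 1
  conv_rhs => rw [← (EuclideanSpace.basisFun (Fin n) ℝ).sum_repr (X x)]
  simp [mul_comm]

theorem continuous_divergence {n : ℕ}
    {X : EuclideanSpace ℝ (Fin n) → EuclideanSpace ℝ (Fin n)} (hX : ContDiff ℝ ∞ X) :
    Continuous (divergence X) := by
  unfold divergence
  have := hX.continuous_fderiv (by simp)
  fun_prop

/-- A family of smooth compactly supported cutoffs, equal to one on larger and larger balls and
with gradients tending to zero. -/
theorem exists_cutoff (n : ℕ) : ∃ (C : ℝ) (χ : ℕ → EuclideanSpace ℝ (Fin n) → ℝ), 0 ≤ C ∧ ∀ k,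
    ContDiff ℝ ∞ (χ k) ∧ HasCompactSupport (χ k) ∧ (∀ x, 0 ≤ χ k x ∧ χ k x ≤ 1) ∧
    (∀ x, ‖x‖ ≤ k + 1 → χ k x = 1) ∧ ∀ x, ‖fderiv ℝ (χ k) x‖ ≤ C / (k + 1) := by
  let b : ContDiffBump (0 : EuclideanSpace ℝ (Fin n)) := ⟨1, 2, by norm_num, by norm_num⟩
  obtain ⟨C, hC⟩ := (b.hasCompactSupport.fderiv (𝕜 := ℝ)).exists_bound_of_continuous
    (b.contDiff.continuous_fderiv (n := ∞) (by simp))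
  refine ⟨C, fun k x => b ((k + 1 : ℝ)⁻¹ • x), (norm_nonneg _).trans (hC 0), fun k => ?_⟩
  have hk : (0 : ℝ) < k + 1 := by positivity
  refine ⟨b.contDiff.comp (contDiff_const_smul _), ?_, fun x => ⟨b.nonneg, b.le_one⟩, ?_, ?_⟩
  · exact b.hasCompactSupport.comp_smul (inv_ne_zero hk.ne')
  · intro x hx
    apply b.one_of_mem_closedBall
    simp only [mem_closedBall_zero_iff, norm_smul, norm_inv, Real.norm_of_nonneg hk.le]
    rw [inv_mul_le_iff₀ hk]; simpa [b] using hx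
  · intro x
    rw [fderiv_comp_smul, norm_smul, norm_inv, Real.norm_of_nonneg hk.le, div_eq_inv_mul]
    gcongr
    exact hC _

theorem abs_setIntegral_fderiv_apply_le {n : ℕ} {E : Set (EuclideanSpace ℝ (Fin n))}
    (hfin : volume E ≠ ⊤) {f : EuclideanSpace ℝ (Fin n) → ℝ} {C : ℝ}
    {X : EuclideanSpace ℝ (Fin n) → EuclideanSpace ℝ (Fin n)} (hX1 : ∀ x, ‖X x‖ ≤ 1)
    (hf : ∀ x, ‖fderiv ℝ f x‖ ≤ C) :
    |∫ x in E, fderiv ℝ f x (X x)| ≤ C * volume.real E := by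
  rw [← Real.norm_eq_abs]
  apply norm_setIntegral_le_of_norm_le_const hfin.lt_top
  intro x _
  calc _ ≤ ‖fderiv ℝ f x‖ * ‖X x‖ := ContinuousLinearMap.le_opNorm _ _
    _ ≤ C * 1 := by
        gcongr
        · exact (norm_nonneg _).trans (hf x)
        · exact hf x
        · exact hX1 x
    _ = C := mul_one C

/-- The truncated fields `χ k • X` compete, and the error `∫_E ∇χ_k · X` is at most `C |E| / (k +
1)` because E has finite volume. Nonnegativity of the divergence allows Fatou in the limit. -/
theorem lintegral_divergence_le_perimeter {n : ℕ} {E : Set (EuclideanSpace ℝ (Fin n))}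
    (hfin : volume E ≠ ⊤)
    {X : EuclideanSpace ℝ (Fin n) → EuclideanSpace ℝ (Fin n)} (hX : ContDiff ℝ ∞ X)
    (hX1 : ∀ x, ‖X x‖ ≤ 1) (hdiv : ∀ x, 0 ≤ divergence X x) :
    ∫⁻ x in E, ENNReal.ofReal (divergence X x) ≤ perimeter E := by
  obtain ⟨C, χ, hC0, hχ⟩ := exists_cutoff n
  have hdc := continuous_divergence hX
  have key : ∀ k, ∫⁻ x in E, ENNReal.ofReal (χ k x * divergence X x) ≤
      perimeter E + ENNReal.ofReal (C * volume.real E / (k + 1)) := by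
    intro k
    obtain ⟨h1, h2, h3, h4, h5⟩ := hχ k
    have hint : Integrable (fun x => χ k x * divergence X x) :=
      (h1.continuous.mul hdc).integrable_of_hasCompactSupport h2.mul_right
    have hfc : Continuous (fun x => fderiv ℝ (χ k) x (X x)) :=
      (h1.continuous_fderiv (by simp)).clm_apply hX.continuous
    have hint2 : Integrable (fun x => fderiv ℝ (χ k) x (X x)) := by
      apply hfc.integrable_of_hasCompactSupport
      refine (h2.fderiv (𝕜 := ℝ)).mono ?_
      intro x hx h0
      simp [h0] at hx
    rw [← ofReal_integral_eq_lintegral_ofReal hint.integrableOn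
      (ae_of_all _ fun x => mul_nonneg (h3 x).1 (hdiv x))]
    have htest : IsTestField univ (fun x => χ k x • X x) :=
      ⟨h1.smul hX, h2.smul_right, subset_univ _, fun x => by
        rw [norm_smul, Real.norm_of_nonneg (h3 x).1]
        exact mul_le_one₀ (h3 x).2 (norm_nonneg _) (hX1 x)⟩
    have hd : ∀ x, divergence (fun y => χ k y • X y) x =
        χ k x * divergence X x + fderiv ℝ (χ k) x (X x) := fun x =>
      divergence_smul (h1.differentiable (by simp) x) (hX.differentiable (by simp) x)
    have hle := le_perimeter_of_isTestField E htest
    simp_rw [hd] at hle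
    rw [integral_add hint.integrableOn hint2.integrableOn] at hle
    have hb := abs_setIntegral_fderiv_apply_le hfin hX1 h5
    calc ENNReal.ofReal (∫ x in E, χ k x * divergence X x)
        ≤ ENNReal.ofReal (((∫ x in E, χ k x * divergence X x) +
            ∫ x in E, fderiv ℝ (χ k) x (X x)) + C * volume.real E / (k + 1)) := by
          apply ENNReal.ofReal_le_ofReal
          have := (abs_le.1 hb).1
          have e : C / ((k : ℝ) + 1) * volume.real E = C * volume.real E / (k + 1) := by ring
          linarith
      _ ≤ _ := ENNReal.ofReal_add_le
      _ ≤ _ := by gcongr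
  have hlim : ∀ x, Tendsto (fun k => ENNReal.ofReal (χ k x * divergence X x)) atTop
      (𝓝 (ENNReal.ofReal (divergence X x))) := by
    intro x
    apply tendsto_const_nhds.congr'
    obtain ⟨N, hN⟩ := exists_nat_ge ‖x‖
    filter_upwards [eventually_ge_atTop N] with k hk
    have : (N : ℝ) ≤ k := by exact_mod_cast hk
    rw [(hχ k).2.2.2.1 x (by linarith), one_mul]
  calc ∫⁻ x in E, ENNReal.ofReal (divergence X x)
      = ∫⁻ x in E, liminf (fun k => ENNReal.ofReal (χ k x * divergence X x)) atTop := by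
        simp_rw [fun x => (hlim x).liminf_eq]
    _ ≤ liminf (fun k => ∫⁻ x in E, ENNReal.ofReal (χ k x * divergence X x)) atTop := by
        apply lintegral_liminf_le
        intro k
        exact (((hχ k).1.continuous.mul hdc).measurable).ennreal_ofReal
    _ ≤ liminf (fun k : ℕ => perimeter E + ENNReal.ofReal (C * volume.real E / (k + 1))) atTop :=
        liminf_le_liminf (Eventually.of_forall key)
    _ = perimeter E + ENNReal.ofReal 0 := by
        apply Tendsto.liminf_eq
        apply Tendsto.add tendsto_const_nhds
        · apply ENNReal.tendsto_ofReal
          exact tendsto_const_nhds.div_atTop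
            (tendsto_atTop_add_const_right _ _ tendsto_natCast_atTop_atTop)
    _ = perimeter E := by simp

/-! ### Lower partial derivatives and mollification -/

/-- The lower derivative of the `i`-th component of `X` in the `i`-th direction, along the
increments `1 / (k + 1)`. -/
noncomputable def lowerPartial {n : ℕ}
    (X : EuclideanSpace ℝ (Fin n) → EuclideanSpace ℝ (Fin n)) (i : Fin n)
    (x : EuclideanSpace ℝ (Fin n)) : ENNReal :=
  liminf (fun k : ℕ => ENNReal.ofReal
    ((k + 1 : ℝ) * (X (x + (k + 1 : ℝ)⁻¹ • EuclideanSpace.single i 1) i - X x i))) atTop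

theorem measurable_lowerPartial {n : ℕ}
    {X : EuclideanSpace ℝ (Fin n) → EuclideanSpace ℝ (Fin n)} (hX : Measurable X) (i : Fin n) :
    Measurable (lowerPartial X i) := by
  unfold lowerPartial
  refine Measurable.liminf fun k => ?_
  fun_prop

theorem tendsto_inv_natCast_add_one :
    Tendsto (fun k : ℕ => ((k + 1 : ℝ))⁻¹) atTop (𝓝[≠] 0) := by
  apply tendsto_nhdsWithin_iff.2 ⟨?_, Eventually.of_forall fun k => ?_⟩
  · exact tendsto_inv_atTop_zero.comp
      (tendsto_atTop_add_const_right _ _ tendsto_natCast_atTop_atTop)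
  · simp only [mem_compl_iff, mem_singleton_iff]; positivity

section Mollify

variable {n : ℕ} {X : EuclideanSpace ℝ (Fin n) → EuclideanSpace ℝ (Fin n)}
  (φ : ContDiffBump (0 : EuclideanSpace ℝ (Fin n)))

/-- The mollification of a vector field. -/
noncomputable def mollify (φ : ContDiffBump (0 : EuclideanSpace ℝ (Fin n)))
    (X : EuclideanSpace ℝ (Fin n) → EuclideanSpace ℝ (Fin n)) :
    EuclideanSpace ℝ (Fin n) → EuclideanSpace ℝ (Fin n) :=
  φ.normed volume ⋆[ContinuousLinearMap.lsmul ℝ ℝ, volume] X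

theorem locallyIntegrable_of_bounded {F : Type*} [NormedAddCommGroup F]
    {f : EuclideanSpace ℝ (Fin n) → F} {C : ℝ} (hf : AEStronglyMeasurable f)
    (hC : ∀ x, ‖f x‖ ≤ C) : LocallyIntegrable f :=
  (locallyIntegrable_const C).mono hf (ae_of_all _ fun x => (hC x).trans (le_abs_self C))

theorem contDiff_mollify (hX : Measurable X) (hX1 : ∀ x, ‖X x‖ ≤ 1) :
    ContDiff ℝ ∞ (mollify φ X) :=
  φ.hasCompactSupport_normed.contDiff_convolution_left _ φ.contDiff_normed
    (locallyIntegrable_of_bounded hX.aestronglyMeasurable hX1)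

theorem integrable_normed_smul_comp {F : Type*} [NormedAddCommGroup F] [NormedSpace ℝ F]
    {f : EuclideanSpace ℝ (Fin n) → F} {C : ℝ} (hf : AEStronglyMeasurable f)
    (hC : ∀ x, ‖f x‖ ≤ C) : Integrable (fun t => φ.normed volume t • f t) :=
  φ.integrable_normed.smul_bdd C hf (ae_of_all _ hC)

theorem norm_mollify_le (hX1 : ∀ x, ‖X x‖ ≤ 1) (x : EuclideanSpace ℝ (Fin n)) :
    ‖mollify φ X x‖ ≤ 1 := by
  calc ‖mollify φ X x‖ ≤ ∫ t, φ.normed volume t := by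
        apply norm_integral_le_of_norm_le φ.integrable_normed
        refine ae_of_all _ fun t => ?_
        simp only [ContinuousLinearMap.lsmul_apply, norm_smul,
          Real.norm_of_nonneg (φ.nonneg_normed t)]
        exact mul_le_of_le_one_right (φ.nonneg_normed t) (hX1 _)
    _ = 1 := φ.integral_normed

theorem mollify_apply (hX : Measurable X) (hX1 : ∀ x, ‖X x‖ ≤ 1) (x : EuclideanSpace ℝ (Fin n))
    (i : Fin n) : mollify φ X x i = ∫ t, φ.normed volume t * X (x - t) i := by
  have hint : Integrable (fun t => φ.normed volume t • X (x - t)) :=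
    integrable_normed_smul_comp φ (Measurable.aestronglyMeasurable (by fun_prop)) (fun t => hX1 (x - t))
  have := (EuclideanSpace.proj (𝕜 := ℝ) i).integral_comp_comm hint
  simpa [mollify, convolution_def] using this.symm

/-- Difference quotients of the mollification are averages of those of X, which are nonnegative by
monotonicity, so Fatou applies. Any singular part of the derivative of X is lost, which is the
favourable direction. -/
theorem lintegral_lowerPartial_le (hX : Measurable X) (hX1 : ∀ x, ‖X x‖ ≤ 1) (i : Fin n)
    (hmono : ∀ (x : EuclideanSpace ℝ (Fin n)) (h : ℝ), 0 ≤ h →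
      X x i ≤ X (x + h • EuclideanSpace.single i 1) i) (x : EuclideanSpace ℝ (Fin n)) :
    0 ≤ fderiv ℝ (mollify φ X) x (EuclideanSpace.single i 1) i ∧
    ∫⁻ t, ENNReal.ofReal (φ.normed volume t) * lowerPartial X i (x - t) ≤
      ENNReal.ofReal (fderiv ℝ (mollify φ X) x (EuclideanSpace.single i 1) i) := by
  set e : EuclideanSpace ℝ (Fin n) := EuclideanSpace.single i 1 with he
  have hb : ∀ y, |X y i| ≤ 1 := fun y => by
    simpa using (PiLp.norm_apply_le (X y) i).trans (hX1 y)
  have hint : ∀ y, Integrable (fun t => φ.normed volume t * X (y - t) i) := fun y =>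
    integrable_normed_smul_comp φ (f := fun t => X (y - t) i)
      (Measurable.aestronglyMeasurable (by fun_prop)) (fun t => hb (y - t))
  have hquot : ∀ k : ℕ, (k + 1 : ℝ) * (mollify φ X (x + (k + 1 : ℝ)⁻¹ • e) i - mollify φ X x i) =
      ∫ t, φ.normed volume t * ((k + 1 : ℝ) * (X (x - t + (k + 1 : ℝ)⁻¹ • e) i - X (x - t) i)) := by
    intro k
    rw [mollify_apply φ hX hX1, mollify_apply φ hX hX1, ← integral_sub (hint _) (hint _),
      ← integral_const_mul]
    congr 1; ext t
    rw [show x + (k + 1 : ℝ)⁻¹ • e - t = x - t + (k + 1 : ℝ)⁻¹ • e by abel]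
    ring
  have hnn : ∀ (k : ℕ) t, 0 ≤ φ.normed volume t *
      ((k + 1 : ℝ) * (X (x - t + (k + 1 : ℝ)⁻¹ • e) i - X (x - t) i)) := fun k t => by
    have := hmono (x - t) (k + 1 : ℝ)⁻¹ (by positivity)
    exact mul_nonneg (φ.nonneg_normed t) (mul_nonneg (by positivity) (by linarith))
  have hd : HasDerivAt (fun t : ℝ => mollify φ X (x + t • e) i)
      (fderiv ℝ (mollify φ X) x e i) 0 := by
    have h1 : HasFDerivAt (mollify φ X) (fderiv ℝ (mollify φ X) x) (x + (0 : ℝ) • e) := by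
      simpa using ((contDiff_mollify φ hX hX1).differentiable (by simp) x).hasFDerivAt
    have h2 : HasDerivAt (fun t : ℝ => x + t • e) e 0 := by
      simpa using ((hasDerivAt_id (0 : ℝ)).smul_const e).const_add x
    exact ((EuclideanSpace.proj (𝕜 := ℝ) i).hasFDerivAt).comp_hasDerivAt _
      (h1.comp_hasDerivAt _ h2)
  have hlim : Tendsto (fun k : ℕ => (k + 1 : ℝ) *
      (mollify φ X (x + (k + 1 : ℝ)⁻¹ • e) i - mollify φ X x i)) atTop
      (𝓝 (fderiv ℝ (mollify φ X) x e i)) := by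
    have h1 := hasDerivAt_iff_tendsto_slope_zero.1 hd
    refine (h1.comp tendsto_inv_natCast_add_one).congr fun k => ?_
    simp
  refine ⟨ge_of_tendsto' hlim fun k => ?_, ?_⟩
  · rw [hquot]; exact integral_nonneg (hnn k)
  calc ∫⁻ t, ENNReal.ofReal (φ.normed volume t) * lowerPartial X i (x - t)
      = ∫⁻ t, liminf (fun k : ℕ => ENNReal.ofReal (φ.normed volume t *
          ((k + 1 : ℝ) * (X (x - t + (k + 1 : ℝ)⁻¹ • e) i - X (x - t) i)))) atTop := by
        congr 1; ext t
        simp_rw [ENNReal.ofReal_mul (φ.nonneg_normed t)]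
        rw [lowerPartial, ENNReal.liminf_const_mul_of_ne_top ENNReal.ofReal_ne_top]
    _ ≤ liminf (fun k : ℕ => ∫⁻ t, ENNReal.ofReal (φ.normed volume t *
          ((k + 1 : ℝ) * (X (x - t + (k + 1 : ℝ)⁻¹ • e) i - X (x - t) i)))) atTop := by
        have hc : Measurable (φ.normed (volume : Measure (EuclideanSpace ℝ (Fin n)))) :=
          φ.continuous_normed.measurable
        exact lintegral_liminf_le fun k => by fun_prop
    _ = liminf (fun k : ℕ => ENNReal.ofReal ((k + 1 : ℝ) *
          (mollify φ X (x + (k + 1 : ℝ)⁻¹ • e) i - mollify φ X x i))) atTop := by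
        congr 1; ext k
        rw [hquot, ofReal_integral_eq_lintegral_ofReal _ (ae_of_all _ (hnn k))]
        have := ((hint (x + (k + 1 : ℝ)⁻¹ • e)).sub (hint x)).const_mul (k + 1 : ℝ)
        refine this.congr (ae_of_all _ fun t => ?_)
        simp only [Pi.sub_apply]
        rw [show x + (k + 1 : ℝ)⁻¹ • e - t = x - t + (k + 1 : ℝ)⁻¹ • e by abel]
        ring
    _ = _ := (ENNReal.tendsto_ofReal hlim).liminf_eq

end Mollify

/-- This replaces the divergence theorem for a merely measurable monotone field: its mollifications
are smooth, bounded by 1, and have divergence at least the mollified sum of lower partials. -/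
theorem lintegral_sum_lowerPartial_le_perimeter {n : ℕ} {E : Set (EuclideanSpace ℝ (Fin n))}
    (hfin : volume E ≠ ⊤)
    {X : EuclideanSpace ℝ (Fin n) → EuclideanSpace ℝ (Fin n)} (hX : Measurable X)
    (hX1 : ∀ x, ‖X x‖ ≤ 1)
    (hmono : ∀ (i : Fin n) (x : EuclideanSpace ℝ (Fin n)) (h : ℝ), 0 ≤ h →
      X x i ≤ X (x + h • EuclideanSpace.single i 1) i) :
    ∫⁻ x in E, ∑ i, lowerPartial X i x ≤ perimeter E := by
  set a : EuclideanSpace ℝ (Fin n) → ENNReal := fun x => ∑ i, lowerPartial X i x with ha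
  have ham : Measurable a := Finset.measurable_sum _ fun i _ => measurable_lowerPartial hX i
  -- The fixed ratio 2 of the radii is the constant `K = 2` in the Lebesgue differentiation theorem
  -- for bumps below.
  let φ : ℕ → ContDiffBump (0 : EuclideanSpace ℝ (Fin n)) := fun j =>
    ⟨1 / (j + 1), 2 * (1 / (j + 1)), by positivity, by
      have : (0 : ℝ) < 1 / (j + 1) := by positivity
      linarith⟩
  have hφ : Tendsto (fun j => (φ j).rOut) atTop (𝓝 0) := by
    have := (tendsto_one_div_add_atTop_nhds_zero_nat (𝕜 := ℝ)).const_mul 2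
    simpa only [mul_zero] using this
  have hdiv : ∀ j x, 0 ≤ divergence (mollify (φ j) X) x ∧
      ∫⁻ t, ENNReal.ofReal ((φ j).normed volume t) * a (x - t) ≤
        ENNReal.ofReal (divergence (mollify (φ j) X) x) := by
    intro j x
    have h := fun i => lintegral_lowerPartial_le (φ j) hX hX1 i (hmono i) x
    refine ⟨Finset.sum_nonneg fun i _ => (h i).1, ?_⟩
    rw [divergence, ENNReal.ofReal_sum_of_nonneg fun i _ => (h i).1]
    simp only [ha, Finset.mul_sum]
    rw [lintegral_finsetSum]
    · exact Finset.sum_le_sum fun i _ => (h i).2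
    · intro i _
      have hc : Measurable ((φ j).normed (volume : Measure (EuclideanSpace ℝ (Fin n)))) :=
        (φ j).continuous_normed.measurable
      have := measurable_lowerPartial hX i
      fun_prop
  -- `a` may be infinite and is not known to be locally integrable; its truncations are bounded, so
  -- almost every point is a Lebesgue point. Monotone convergence removes N at the end.
  have htrunc : ∀ N : ℕ, ∫⁻ x in E, min (a x) N ≤ perimeter E := by
    intro N
    have hne : ∀ x, min (a x) N ≠ ⊤ := fun x => ne_top_of_le_ne_top (ENNReal.natCast_ne_top N)
      (min_le_right _ _)
    set b : EuclideanSpace ℝ (Fin n) → ℝ := fun x => (min (a x) N).toReal with hb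
    have hbm : Measurable b := (ham.min measurable_const).ennreal_toReal
    have hb0 : ∀ x, 0 ≤ b x := fun x => ENNReal.toReal_nonneg
    have hbN : ∀ x, ‖b x‖ ≤ N := fun x => by
      rw [Real.norm_of_nonneg (hb0 x)]
      exact ENNReal.toReal_le_of_le_ofReal (by positivity) (by simp)
    have hconv := ContDiffBump.ae_convolution_tendsto_right_of_locallyIntegrable (K := 2) hφ
      (Eventually.of_forall fun j => le_rfl)
      (locallyIntegrable_of_bounded hbm.aestronglyMeasurable hbN)
    have hle : ∀ j x, ENNReal.ofReal (((φ j).normed volume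
        ⋆[ContinuousLinearMap.lsmul ℝ ℝ, volume] b) x) ≤
        ENNReal.ofReal (divergence (mollify (φ j) X) x) := by
      intro j x
      refine le_trans ?_ (hdiv j x).2
      rw [convolution_def]
      simp only [ContinuousLinearMap.lsmul_apply]
      rw [ofReal_integral_eq_lintegral_ofReal]
      · apply lintegral_mono
        intro t
        simp only [smul_eq_mul]
        rw [ENNReal.ofReal_mul ((φ j).nonneg_normed t), hb, ENNReal.ofReal_toReal (hne _)]
        gcongr
        exact min_le_left _ _
      · exact integrable_normed_smul_comp (φ j) (f := fun t => b (x - t))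
            (hbm.comp (measurable_const.sub measurable_id)).aestronglyMeasurable
          (fun t => hbN (x - t))
      · exact ae_of_all _ fun t => mul_nonneg ((φ j).nonneg_normed t) (hb0 _)
    calc ∫⁻ x in E, min (a x) N
        ≤ ∫⁻ x in E, liminf (fun j => ENNReal.ofReal (divergence (mollify (φ j) X) x)) atTop := by
          apply lintegral_mono_ae
          filter_upwards [ae_restrict_of_ae hconv] with x hx
          rw [← ENNReal.ofReal_toReal (hne x), ← (ENNReal.tendsto_ofReal hx).liminf_eq]
          exact liminf_le_liminf (Eventually.of_forall fun j => hle j x)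
      _ ≤ liminf (fun j => ∫⁻ x in E, ENNReal.ofReal (divergence (mollify (φ j) X) x)) atTop :=
          lintegral_liminf_le fun j =>
            (continuous_divergence (contDiff_mollify (φ j) hX hX1)).measurable.ennreal_ofReal
      _ ≤ liminf (fun _ : ℕ => perimeter E) atTop :=
          liminf_le_liminf (Eventually.of_forall fun j => lintegral_divergence_le_perimeter hfin
            (contDiff_mollify (φ j) hX hX1) (norm_mollify_le (φ j) hX1) fun x => (hdiv j x).1)
      _ = perimeter E := liminf_const _
  have hsup : ∀ x, a x = ⨆ N : ℕ, min (a x) N := fun x => by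
    rw [← inf_iSup_eq, ENNReal.iSup_natCast, inf_top_eq]
  calc ∫⁻ x in E, a x = ∫⁻ x in E, ⨆ N : ℕ, min (a x) N := by simp_rw [← hsup]
    _ = ⨆ N : ℕ, ∫⁻ x in E, min (a x) N := by
        apply lintegral_iSup
        · exact fun N => ham.min measurable_const
        · intro N M hNM x
          exact min_le_min_left _ (by exact_mod_cast hNM)
    _ ≤ perimeter E := iSup_le htrunc

/-! ### Slicing by the first coordinate -/

section Slices

variable {n : ℕ}

theorem measurePreserving_cons (n : ℕ) : MeasurePreserving
    (fun p : ℝ × (Fin n → ℝ) => (Fin.cons p.1 p.2 : Fin (n + 1) → ℝ)) := by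
  have h := (volume_preserving_piFinSuccAbove (fun _ : Fin (n + 1) => ℝ) 0).symm
  convert h using 1
  ext p i
  refine Fin.cases ?_ (fun j => ?_) i <;> simp [MeasurableEquiv.piFinSuccAbove]

theorem measurable_cons : Measurable
    (fun p : ℝ × (Fin n → ℝ) => (Fin.cons p.1 p.2 : Fin (n + 1) → ℝ)) :=
  (measurePreserving_cons n).measurable

/-- The slice of a subset of `ℝⁿ⁺¹` at height `t` in the first coordinate. -/
def slice (S : Set (Fin (n + 1) → ℝ)) (t : ℝ) : Set (Fin n → ℝ) :=
  {z | (Fin.cons t z : Fin (n + 1) → ℝ) ∈ S}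

theorem measurable_volume_slice {S : Set (Fin (n + 1) → ℝ)} (hS : MeasurableSet S) :
    Measurable fun t => volume (slice S t) :=
  measurable_measure_prodMk_left (measurable_cons hS)

theorem volume_eq_lintegral_slice {S : Set (Fin (n + 1) → ℝ)} (hS : MeasurableSet S) :
    volume S = ∫⁻ t, volume (slice S t) := by
  rw [← (measurePreserving_cons n).measure_preimage hS.nullMeasurableSet,
    Measure.volume_eq_prod, Measure.prod_apply (measurable_cons hS)]
  rfl

theorem volume_inter_first_eq_setLIntegral {S : Set (Fin (n + 1) → ℝ)} (hS : MeasurableSet S)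
    {A : Set ℝ} (hA : MeasurableSet A) :
    volume (S ∩ {x | x 0 ∈ A}) = ∫⁻ t in A, volume (slice S t) := by
  have hA' : MeasurableSet {x : Fin (n + 1) → ℝ | x 0 ∈ A} := (measurable_pi_apply 0) hA
  rw [volume_eq_lintegral_slice (hS.inter hA'),
    ← lintegral_indicator hA]
  congr 1; ext t
  by_cases ht : t ∈ A
  · rw [indicator_of_mem ht]
    congr 1; ext z; simp [slice, ht]
  · rw [indicator_of_notMem ht]
    convert measure_empty (μ := volume) (α := Fin n → ℝ)
    ext z; simp [slice, ht]

theorem ae_of_ae_slice {p : (Fin (n + 1) → ℝ) → Prop} (hp : MeasurableSet {x | p x})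
    (h : ∀ᵐ t : ℝ, ∀ᵐ z : Fin n → ℝ, p (Fin.cons t z)) : ∀ᵐ x, p x := by
  have h1 : ∀ᵐ q : ℝ × (Fin n → ℝ), p (Fin.cons q.1 q.2) := by
    rw [Measure.volume_eq_prod]
    exact (Measure.ae_prod_mem_iff_ae_ae_mem (measurable_cons hp)).2 h
  rw [← (measurePreserving_cons n).map_eq]
  exact (ae_map_iff measurable_cons.aemeasurable hp).2 h1

/-- The normalized distribution of the first coordinate on a set. -/
noncomputable def firstMarginal (S : Set (Fin (n + 1) → ℝ)) : Measure ℝ :=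
  (volume S)⁻¹ • (volume.restrict S).map (fun x => x 0)

theorem firstMarginal_apply (S : Set (Fin (n + 1) → ℝ)) {A : Set ℝ}
    (hA : MeasurableSet A) : firstMarginal S A = volume (S ∩ {x | x 0 ∈ A}) / volume S := by
  rw [firstMarginal, Measure.smul_apply, Measure.map_apply (measurable_pi_apply 0) hA,
    Measure.restrict_apply ((measurable_pi_apply 0) hA), smul_eq_mul, ENNReal.div_eq_inv_mul,
    inter_comm]
  rfl

theorem isProbabilityMeasure_firstMarginal {S : Set (Fin (n + 1) → ℝ)} (h0 : volume S ≠ 0)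
    (h1 : volume S ≠ ⊤) : IsProbabilityMeasure (firstMarginal S) :=
  ⟨by rw [firstMarginal_apply S MeasurableSet.univ]; simp [ENNReal.div_self h0 h1]⟩

theorem firstMarginal_eq_withDensity {S : Set (Fin (n + 1) → ℝ)} (hS : MeasurableSet S) :
    firstMarginal S = volume.withDensity fun t => volume (slice S t) / volume S := by
  ext A hA
  rw [firstMarginal_apply S hA, withDensity_apply _ hA, volume_inter_first_eq_setLIntegral hS hA]
  simp_rw [ENNReal.div_eq_inv_mul]
  rw [lintegral_const_mul _ (measurable_volume_slice hS)]

end Slices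

/-! ### Derivatives of distribution functions -/

section Cdf

theorem ae_hasDerivAt_cdf {μ : Measure ℝ} [IsProbabilityMeasure μ] {f : ℝ → ENNReal}
    (hf : Measurable f) (hμ : μ = volume.withDensity f) :
    ∀ᵐ t, HasDerivAt (cdf μ) (f t).toReal t := by
  have h := (cdf μ).ae_hasDerivAt
  rw [measure_cdf] at h
  filter_upwards [h, hμ ▸ Measure.rnDeriv_withDensity volume hf] with t h1 h2
  rwa [h2] at h1

theorem cdf_sub_cdf {μ : Measure ℝ} [IsProbabilityMeasure μ] {s t : ℝ} (hst : s ≤ t) :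
    cdf μ t - cdf μ s = μ.real (Ioc s t) := by
  conv_rhs => rw [← measure_cdf μ]
  rw [measureReal_def, StieltjesFunction.measure_Ioc, ENNReal.toReal_ofReal]
  linarith [monotone_cdf μ hst]

/-- The fundamental theorem of calculus gives the derivative at every point of the interval, not
just almost every one. It serves the ball and, in the equality case, the passage from an a.e.
equation for E to one valid everywhere. -/
theorem hasDerivAt_cdf_of_continuousOn {μ : Measure ℝ} [IsProbabilityMeasure μ] {f : ℝ → ENNReal}
    (hμ : μ = volume.withDensity f) {a b t : ℝ} (ht : t ∈ Ioo a b)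
    {g : ℝ → ℝ} (hg : ContinuousOn g (Ioo a b)) (hg0 : ∀ s ∈ Ioo a b, 0 ≤ g s)
    (hfg : ∀ᵐ s, s ∈ Ioo a b → f s = ENNReal.ofReal (g s)) :
    HasDerivAt (cdf μ) (g t) t := by
  have hIcc : ∀ {u v}, u ∈ Ioo a b → v ∈ Ioo a b → Icc u v ⊆ Ioo a b := fun hu hv =>
    (ordConnected_Ioo).out hu hv
  have hint : ∀ {u v}, u ∈ Ioo a b → v ∈ Ioo a b → IntervalIntegrable g volume u v := fun hu hv =>
    (hg.mono (ordConnected_Ioo.uIcc_subset hu hv)).intervalIntegrable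
  have hle : ∀ {u v}, u ∈ Ioo a b → v ∈ Ioo a b → u ≤ v →
      cdf μ v - cdf μ u = ∫ s in u..v, g s := by
    intro u v hu hv huv
    rw [cdf_sub_cdf huv, intervalIntegral.integral_of_le huv, measureReal_def, hμ,
      withDensity_apply _ measurableSet_Ioc, integral_eq_lintegral_of_nonneg_ae]
    · congr 1
      apply setLIntegral_congr_fun_ae measurableSet_Ioc
      filter_upwards [hfg] with s hs h
      exact hs (hIcc hu hv (Ioc_subset_Icc_self h))
    · exact (ae_restrict_iff' measurableSet_Ioc).2
        (ae_of_all _ fun s hs => hg0 s (hIcc hu hv (Ioc_subset_Icc_self hs)))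
    · exact ((intervalIntegrable_iff_integrableOn_Ioc_of_le huv).1 (hint hu hv)).1
  have hall : ∀ u ∈ Ioo a b, cdf μ u = cdf μ t + ∫ s in t..u, g s := by
    intro u hu
    rcases le_total t u with h | h
    · linarith [hle ht hu h]
    · rw [intervalIntegral.integral_symm]
      linarith [hle hu ht h]
  have hmem : Ioo a b ∈ 𝓝 t := isOpen_Ioo.mem_nhds ht
  have h1 : HasDerivAt (fun u => ∫ s in t..u, g s) (g t) t :=
    intervalIntegral.integral_hasDerivAt_right (by simp)
      (hg.stronglyMeasurableAtFilter isOpen_Ioo t ht) (hg.continuousAt hmem)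
  exact (h1.const_add (cdf μ t)).congr_of_eventuallyEq (by
    filter_upwards [hmem] with u hu using hall u hu)

end Cdf

/-! ### The unit ball in coordinates, its first marginal and quantile function -/

/-- The Euclidean unit ball in coordinates. -/
def coordBall (n : ℕ) : Set (Fin n → ℝ) := {x | ∑ i, x i ^ 2 < 1}

theorem measurableSet_coordBall (n : ℕ) : MeasurableSet (coordBall n) :=
  measurableSet_lt (by fun_prop) measurable_const

theorem ofLp_preimage_coordBall (n : ℕ) :
    (fun x : EuclideanSpace ℝ (Fin n) => x.ofLp) ⁻¹' coordBall n = Metric.ball 0 1 := by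
  ext x
  simp only [coordBall, mem_preimage, mem_ofPred_eq, mem_ball_zero_iff]
  rw [← EuclideanSpace.real_norm_sq_eq, sq_lt_one_iff₀ (norm_nonneg _)]

theorem volume_coordBall (n : ℕ) :
    volume (coordBall n) = volume (Metric.ball (0 : EuclideanSpace ℝ (Fin n)) 1) := by
  rw [← ofLp_preimage_coordBall]
  exact ((PiLp.volume_preserving_ofLp (Fin n)).measure_preimage
    (measurableSet_coordBall n).nullMeasurableSet).symm

theorem volume_coordBall_ne_zero (n : ℕ) : volume (coordBall n) ≠ 0 := by
  rw [volume_coordBall]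
  exact (Metric.measure_ball_pos volume _ one_pos).ne'

theorem volume_coordBall_ne_top (n : ℕ) : volume (coordBall n) ≠ ⊤ := by
  rw [volume_coordBall]
  exact measure_ball_lt_top.ne

instance (n : ℕ) : IsProbabilityMeasure (firstMarginal (coordBall (n + 1))) :=
  isProbabilityMeasure_firstMarginal (volume_coordBall_ne_zero _) (volume_coordBall_ne_top _)

/-- The slice is the lower-dimensional unit ball scaled by `√(1 - t ^ 2)`. -/
theorem volume_slice_coordBall {n : ℕ} {t : ℝ} (ht : t ∈ Ioo (-1 : ℝ) 1) :
    volume (slice (coordBall (n + 1)) t) =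
      ENNReal.ofReal (√(1 - t ^ 2) ^ n) * volume (coordBall n) := by
  have hpos : 0 < 1 - t ^ 2 := by nlinarith [ht.1, ht.2]
  have hr : 0 < √(1 - t ^ 2) := Real.sqrt_pos.2 hpos
  have h : slice (coordBall (n + 1)) t = √(1 - t ^ 2) • coordBall n := by
    ext z
    rw [mem_smul_set_iff_inv_smul_mem₀ hr.ne']
    simp only [slice, coordBall, mem_ofPred_eq, Fin.sum_univ_succ, Fin.cons_zero, Fin.cons_succ,
      Pi.smul_apply, smul_eq_mul, mul_pow, ← Finset.mul_sum, inv_pow, Real.sq_sqrt hpos.le]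
    rw [inv_mul_lt_iff₀ hpos]
    constructor <;> intro <;> linarith
  rw [h, Measure.addHaar_smul]
  simp [abs_of_pos (pow_pos hr n)]

/-- The density of the first marginal of the unit ball of `ℝⁿ⁺¹`. -/
noncomputable def ballDensity (n : ℕ) (t : ℝ) : ℝ :=
  √(1 - t ^ 2) ^ n * (volume (coordBall n)).toReal / (volume (coordBall (n + 1))).toReal

theorem continuous_ballDensity (n : ℕ) : Continuous (ballDensity n) := by
  unfold ballDensity
  fun_prop

theorem ballDensity_pos (n : ℕ) {t : ℝ} (ht : t ∈ Ioo (-1 : ℝ) 1) : 0 < ballDensity n t := by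
  have hpos : 0 < 1 - t ^ 2 := by nlinarith [ht.1, ht.2]
  have h1 := ENNReal.toReal_pos (volume_coordBall_ne_zero n) (volume_coordBall_ne_top n)
  have h2 := ENNReal.toReal_pos (volume_coordBall_ne_zero (n + 1)) (volume_coordBall_ne_top (n + 1))
  unfold ballDensity
  positivity

/-- The distribution function of the first coordinate on the unit ball of `ℝⁿ⁺¹`. -/
noncomputable def ballCdf (n : ℕ) : ℝ → ℝ := cdf (firstMarginal (coordBall (n + 1)))

theorem monotone_ballCdf (n : ℕ) : Monotone (ballCdf n) := monotone_cdf _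

theorem hasDerivAt_ballCdf {n : ℕ} {t : ℝ} (ht : t ∈ Ioo (-1 : ℝ) 1) :
    HasDerivAt (ballCdf n) (ballDensity n t) t := by
  refine hasDerivAt_cdf_of_continuousOn
    (firstMarginal_eq_withDensity (measurableSet_coordBall (n + 1))) ht
    (continuous_ballDensity n).continuousOn (fun s hs => (ballDensity_pos n hs).le)
    (ae_of_all _ fun s hs => ?_)
  rw [volume_slice_coordBall hs, ballDensity, ENNReal.ofReal_div_of_pos
    (ENNReal.toReal_pos (volume_coordBall_ne_zero _) (volume_coordBall_ne_top _)),
    ENNReal.ofReal_mul (by positivity), ENNReal.ofReal_toReal (volume_coordBall_ne_top _),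
    ENNReal.ofReal_toReal (volume_coordBall_ne_top _)]

theorem first_mem_Ioo_of_mem_coordBall {n : ℕ} {x : Fin (n + 1) → ℝ} (hx : x ∈ coordBall (n + 1)) :
    x 0 ∈ Ioo (-1 : ℝ) 1 := by
  have h : ∑ i, x i ^ 2 < 1 := hx
  rw [Fin.sum_univ_succ] at h
  have : 0 ≤ ∑ i : Fin n, x i.succ ^ 2 := Finset.sum_nonneg fun i _ => sq_nonneg _
  constructor <;> nlinarith

theorem ballCdf_of_le {n : ℕ} {t : ℝ} (ht : t ≤ -1) : ballCdf n t = 0 := by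
  rw [ballCdf, cdf_eq_real, measureReal_def, firstMarginal_apply _ measurableSet_Iic]
  have : coordBall (n + 1) ∩ {x | x 0 ∈ Iic t} = ∅ := by
    ext x
    simp only [mem_inter_iff, mem_ofPred_eq, mem_Iic, mem_empty_iff_false, iff_false, not_and]
    intro hx
    linarith [(first_mem_Ioo_of_mem_coordBall hx).1]
  rw [this]; simp

theorem ballCdf_of_ge {n : ℕ} {t : ℝ} (ht : 1 ≤ t) : ballCdf n t = 1 := by
  rw [ballCdf, cdf_eq_real, measureReal_def, firstMarginal_apply _ measurableSet_Iic]
  have : coordBall (n + 1) ∩ {x | x 0 ∈ Iic t} = coordBall (n + 1) := by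
    ext x
    simp only [mem_inter_iff, mem_ofPred_eq, mem_Iic, and_iff_left_iff_imp]
    intro hx
    linarith [(first_mem_Ioo_of_mem_coordBall hx).2]
  rw [this, ENNReal.div_self (volume_coordBall_ne_zero _) (volume_coordBall_ne_top _)]
  rfl

/-- A jump of the distribution function would be an atom of `μ`. -/
theorem continuous_cdf_of_eq_withDensity {μ : Measure ℝ} [IsProbabilityMeasure μ]
    {f : ℝ → ENNReal} (hμ : μ = volume.withDensity f) : Continuous (cdf μ) := by
  rw [continuous_iff_continuousAt]
  intro t
  rw [(cdf μ).mono.continuousAt_iff_leftLim_eq_rightLim, StieltjesFunction.rightLim_eq]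
  have h1 : (cdf μ).measure {t} = 0 := by
    rw [measure_cdf, hμ]
    exact withDensity_absolutelyContinuous _ _ (by simp)
  rw [StieltjesFunction.measure_singleton, ENNReal.ofReal_eq_zero] at h1
  exact le_antisymm ((cdf μ).mono.leftLim_le le_rfl) (by linarith)

theorem continuous_cdf_firstMarginal {n : ℕ} {S : Set (Fin (n + 1) → ℝ)} (hS : MeasurableSet S)
    [IsProbabilityMeasure (firstMarginal S)] : Continuous (cdf (firstMarginal S)) :=
  continuous_cdf_of_eq_withDensity (firstMarginal_eq_withDensity hS)

theorem continuous_ballCdf (n : ℕ) : Continuous (ballCdf n) :=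
  continuous_cdf_firstMarginal (measurableSet_coordBall (n + 1))

theorem strictMonoOn_ballCdf (n : ℕ) : StrictMonoOn (ballCdf n) (Icc (-1) 1) := by
  refine strictMonoOn_of_deriv_pos (convex_Icc _ _) (continuous_ballCdf n).continuousOn ?_
  intro t ht
  rw [interior_Icc] at ht
  rw [(hasDerivAt_ballCdf ht).deriv]
  exact ballDensity_pos n ht

/-- Clamping `q` to [0, 1] makes the quantile function total and monotone on the whole line. -/
theorem exists_ballCdf_eq (n : ℕ) (q : ℝ) :
    ∃ s ∈ Icc (-1 : ℝ) 1, ballCdf n s = max 0 (min q 1) := by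
  have h := intermediate_value_Icc (show (-1 : ℝ) ≤ 1 by norm_num)
    (continuous_ballCdf n).continuousOn
  rw [ballCdf_of_le le_rfl, ballCdf_of_ge le_rfl] at h
  exact h ⟨le_max_left _ _, max_le zero_le_one (min_le_right _ _)⟩

/-- The quantile function of the first coordinate on the unit ball of `ℝⁿ⁺¹`. -/
noncomputable def ballQuantile (n : ℕ) (q : ℝ) : ℝ := (exists_ballCdf_eq n q).choose

theorem ballQuantile_mem_Icc (n : ℕ) (q : ℝ) : ballQuantile n q ∈ Icc (-1 : ℝ) 1 :=
  (exists_ballCdf_eq n q).choose_spec.1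

theorem ballCdf_ballQuantile {n : ℕ} {q : ℝ} (hq : q ∈ Icc (0 : ℝ) 1) :
    ballCdf n (ballQuantile n q) = q := by
  rw [ballQuantile, (exists_ballCdf_eq n q).choose_spec.2, min_eq_left hq.2, max_eq_right hq.1]

theorem ballQuantile_ballCdf {n : ℕ} {s : ℝ} (hs : s ∈ Icc (-1 : ℝ) 1) :
    ballQuantile n (ballCdf n s) = s :=
  (strictMonoOn_ballCdf n).injOn (ballQuantile_mem_Icc n _) hs
    (ballCdf_ballQuantile ⟨cdf_nonneg _ _, cdf_le_one _ _⟩)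

theorem monotone_ballQuantile (n : ℕ) : Monotone (ballQuantile n) := by
  intro p q hpq
  rw [← (strictMonoOn_ballCdf n).le_iff_le (ballQuantile_mem_Icc n _) (ballQuantile_mem_Icc n _),
    ballQuantile, ballQuantile, (exists_ballCdf_eq n p).choose_spec.2,
    (exists_ballCdf_eq n q).choose_spec.2]
  gcongr

theorem ballQuantile_mem_Ioo {n : ℕ} {q : ℝ} (hq : q ∈ Ioo (0 : ℝ) 1) :
    ballQuantile n q ∈ Ioo (-1 : ℝ) 1 := by
  have h := ballCdf_ballQuantile (n := n) (Ioo_subset_Icc_self hq)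
  refine ⟨lt_of_not_ge fun h' => ?_, lt_of_not_ge fun h' => ?_⟩
  · rw [ballCdf_of_le h'] at h
    exact hq.1.ne h
  · rw [ballCdf_of_ge h'] at h
    exact hq.2.ne' h

theorem ballCdf_mem_Ioo {n : ℕ} {s : ℝ} (hs : s ∈ Ioo (-1 : ℝ) 1) : ballCdf n s ∈ Ioo (0 : ℝ) 1 := by
  constructor
  · rw [← ballCdf_of_le (n := n) le_rfl]
    exact strictMonoOn_ballCdf n (by simp) (Ioo_subset_Icc_self hs) hs.1
  · rw [← ballCdf_of_ge (n := n) le_rfl]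
    exact strictMonoOn_ballCdf n (Ioo_subset_Icc_self hs) (by simp) hs.2

theorem continuousAt_ballQuantile {n : ℕ} {q : ℝ} (hq : q ∈ Ioo (0 : ℝ) 1) :
    ContinuousAt (ballQuantile n) q := by
  refine continuousAt_of_monotoneOn_of_image_mem_nhds
    ((monotone_ballQuantile n).monotoneOn (Ioo 0 1)) (isOpen_Ioo.mem_nhds hq) ?_
  refine mem_of_superset (isOpen_Ioo.mem_nhds (ballQuantile_mem_Ioo hq)) fun s hs => ?_
  exact ⟨ballCdf n s, ballCdf_mem_Ioo hs, ballQuantile_ballCdf (Ioo_subset_Icc_self hs)⟩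

theorem hasDerivAt_ballQuantile {n : ℕ} {q : ℝ} (hq : q ∈ Ioo (0 : ℝ) 1) :
    HasDerivAt (ballQuantile n) (ballDensity n (ballQuantile n q))⁻¹ q :=
  HasDerivAt.of_local_left_inverse (continuousAt_ballQuantile hq)
    (hasDerivAt_ballCdf (ballQuantile_mem_Ioo hq)) (ballDensity_pos n (ballQuantile_mem_Ioo hq)).ne'
    (by filter_upwards [isOpen_Ioo.mem_nhds hq] with p hp
        using ballCdf_ballQuantile (Ioo_subset_Icc_self hp))

/-! ### The Knothe map -/

/-- The lower derivative of a function of one variable along the increments `1 / (k + 1)`. -/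
noncomputable def lowerDeriv (u : ℝ → ℝ) (t : ℝ) : ENNReal :=
  liminf (fun k : ℕ => ENNReal.ofReal ((k + 1 : ℝ) * (u (t + (k + 1 : ℝ)⁻¹) - u t))) atTop

theorem lowerDeriv_eq_of_hasDerivAt {u : ℝ → ℝ} {t a : ℝ} (h : HasDerivAt u a t) :
    lowerDeriv u t = ENNReal.ofReal a := by
  apply Tendsto.liminf_eq
  apply ENNReal.tendsto_ofReal
  refine ((hasDerivAt_iff_tendsto_slope_zero.1 h).comp tendsto_inv_natCast_add_one).congr
    fun k => ?_
  simp

section Knothe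

variable {Y : Type} {n : ℕ}

/-- The proportion of the set `S` lying below height `t` in the first coordinate. -/
noncomputable def firstCdf (S : Set (Fin (n + 1) → ℝ)) (t : ℝ) : ℝ :=
  (volume (S ∩ {x | x 0 ∈ Iic t}) / volume S).toReal

/-- With the conventions of `ENNReal` division this needs no hypothesis on S: null and infinite sets
give ratio 0. Hence the transport is monotone for every value of the parameter, degenerate slices
included. -/
theorem firstCdf_ratio_le_one (S : Set (Fin (n + 1) → ℝ)) (t : ℝ) :
    volume (S ∩ {x | x 0 ∈ Iic t}) / volume S ≤ 1 :=
  (ENNReal.div_le_div_right (measure_mono inter_subset_left) _).trans ENNReal.div_self_le_one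

theorem monotone_firstCdf (S : Set (Fin (n + 1) → ℝ)) : Monotone (firstCdf S) := by
  intro s t hst
  refine ENNReal.toReal_mono
    (ne_top_of_le_ne_top ENNReal.one_ne_top (firstCdf_ratio_le_one S t)) ?_
  refine ENNReal.div_le_div_right (measure_mono ?_) _
  exact inter_subset_inter_right _ fun x (hx : x 0 ≤ s) => hx.trans hst

theorem firstCdf_mem_Icc (S : Set (Fin (n + 1) → ℝ)) (t : ℝ) : firstCdf S t ∈ Icc (0 : ℝ) 1 :=
  ⟨ENNReal.toReal_nonneg, ENNReal.toReal_le_of_le_ofReal zero_le_one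
    (by simpa using firstCdf_ratio_le_one S t)⟩

theorem firstCdf_eq_cdf {S : Set (Fin (n + 1) → ℝ)} [IsProbabilityMeasure (firstMarginal S)] :
    firstCdf S = cdf (firstMarginal S) := by
  ext t
  rw [cdf_eq_real, measureReal_def, firstMarginal_apply _ measurableSet_Iic, firstCdf]

theorem ae_hasDerivAt_firstCdf {S : Set (Fin (n + 1) → ℝ)} (hS : MeasurableSet S)
    (h0 : volume S ≠ 0) (h1 : volume S ≠ ⊤) :
    ∀ᵐ t, HasDerivAt (firstCdf S) (volume (slice S t) / volume S).toReal t := by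
  have := isProbabilityMeasure_firstMarginal h0 h1
  rw [firstCdf_eq_cdf]
  exact ae_hasDerivAt_cdf ((measurable_volume_slice hS).div_const _)
    (firstMarginal_eq_withDensity hS)

/-- The values 0 and 1 are extremal, so the derivative vanishes where they are attained. -/
theorem firstCdf_mem_Ioo_of_hasDerivAt {S : Set (Fin (n + 1) → ℝ)} {t a : ℝ}
    (h : HasDerivAt (firstCdf S) a t) (ha : a ≠ 0) : firstCdf S t ∈ Ioo (0 : ℝ) 1 := by
  refine ⟨lt_of_le_of_ne (firstCdf_mem_Icc S t).1 fun h0 => ha ?_,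
    lt_of_le_of_ne (firstCdf_mem_Icc S t).2 fun h1 => ha ?_⟩
  · refine IsLocalMin.hasDerivAt_eq_zero (Eventually.of_forall fun s => ?_) h
    rw [← h0]; exact (firstCdf_mem_Icc S s).1
  · refine IsLocalMax.hasDerivAt_eq_zero (Eventually.of_forall fun s => ?_) h
    rw [h1]; exact (firstCdf_mem_Icc S s).2

/-- The monotone rearrangement of the first marginal of `S` onto that of the unit ball. -/
noncomputable def firstTransport (S : Set (Fin (n + 1) → ℝ)) (t : ℝ) : ℝ :=
  ballQuantile n (firstCdf S t)

/-- Joint measurability in parameter and height is needed because the parameter carries the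
coordinates already treated. -/
theorem measurable_firstTransport [MeasurableSpace Y] {E : Set (Y × (Fin (n + 1) → ℝ))} (hE : MeasurableSet E) :
    Measurable fun p : Y × ℝ => firstTransport (Prod.mk p.1 ⁻¹' E) p.2 := by
  refine (monotone_ballQuantile n).measurable.comp ?_
  refine (Measurable.div ?_ ?_).ennreal_toReal
  · have : MeasurableSet {q : (Y × ℝ) × (Fin (n + 1) → ℝ) | (q.1.1, q.2) ∈ E ∧ q.2 0 ≤ q.1.2} :=
      (measurableSet_preimage (f := fun q : (Y × ℝ) × (Fin (n + 1) → ℝ) => (q.1.1, q.2))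
        (by fun_prop) hE).inter (measurableSet_le (f := fun q : (Y × ℝ) × (Fin (n + 1) → ℝ) => q.2 0)
        (g := fun q : (Y × ℝ) × (Fin (n + 1) → ℝ) => q.1.2) (by fun_prop) (by fun_prop))
    exact measurable_measure_prodMk_left this
  · exact (measurable_measure_prodMk_left hE).comp measurable_fst

/-- A measurable field of maps, depending on a parameter, into the Euclidean unit ball whose
`i`-th components are nondecreasing in the `i`-th variable. -/
structure IsMonotoneField [MeasurableSpace Y] (X : Y × (Fin n → ℝ) → Fin n → ℝ) : Prop where
  measurable : Measurable X
  sum_sq_le_one : ∀ p, ∑ i, X p i ^ 2 ≤ 1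
  mono : ∀ y x i (h : ℝ), 0 ≤ h → X (y, x) i ≤ X (y, x + h • Pi.single i 1) i

/-- The lower partial derivative of `X i` in the `i`-th variable, for coordinates. -/
noncomputable def coordPartial (X : (Fin n → ℝ) → Fin n → ℝ) (i : Fin n) (x : Fin n → ℝ) :
    ENNReal :=
  lowerDeriv (fun h => X (x + h • Pi.single i 1) i) 0

theorem measurable_coordPartial [MeasurableSpace Y] {X : Y × (Fin n → ℝ) → Fin n → ℝ} (hX : Measurable X) (i : Fin n) :
    Measurable fun p : Y × (Fin n → ℝ) => coordPartial (fun x => X (p.1, x)) i p.2 := by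
  unfold coordPartial lowerDeriv
  refine Measurable.liminf fun k => ?_
  fun_prop

/-- The Knothe extension of a field in the last variables by a transport of the first one. -/
noncomputable def knotheStep (E : Set (Y × (Fin (n + 1) → ℝ)))
    (X : (Y × ℝ) × (Fin n → ℝ) → Fin n → ℝ) : Y × (Fin (n + 1) → ℝ) → Fin (n + 1) → ℝ :=
  fun p => Fin.cons (firstTransport (Prod.mk p.1 ⁻¹' E) (p.2 0))
    (√(1 - firstTransport (Prod.mk p.1 ⁻¹' E) (p.2 0) ^ 2) • X ((p.1, p.2 0), Fin.tail p.2))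

/-- The length bound is `T² + (1 - T²)|X|² ≤ 1`. Moving a later variable changes neither T nor the
slice, so monotonicity there is inherited from X. -/
theorem isMonotoneField_knotheStep [MeasurableSpace Y] {E : Set (Y × (Fin (n + 1) → ℝ))} (hE : MeasurableSet E)
    {X : (Y × ℝ) × (Fin n → ℝ) → Fin n → ℝ} (hX : IsMonotoneField X) :
    IsMonotoneField (knotheStep E X) := by
  have hT : ∀ p : Y × ℝ, firstTransport (Prod.mk p.1 ⁻¹' E) p.2 ^ 2 ≤ 1 := fun p => by
    have := ballQuantile_mem_Icc n (firstCdf (Prod.mk p.1 ⁻¹' E) p.2)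
    rw [sq_le_one_iff_abs_le_one, abs_le]
    exact this
  refine ⟨?_, fun p => ?_, fun y x i h hh => ?_⟩
  · have h1 : Measurable fun p : Y × (Fin (n + 1) → ℝ) =>
        firstTransport (Prod.mk p.1 ⁻¹' E) (p.2 0) := by
      have hf : Measurable fun p : Y × (Fin (n + 1) → ℝ) => (p.1, p.2 0) := by fun_prop
      have h := (measurable_firstTransport hE).comp hf
      simp only [Function.comp_def] at h
      exact h
    have h2 : Measurable fun p : Y × (Fin (n + 1) → ℝ) => X ((p.1, p.2 0), Fin.tail p.2) := by
      refine hX.measurable.comp (Measurable.prodMk (by fun_prop) ?_)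
      exact measurable_pi_lambda _ fun i => by unfold Fin.tail; fun_prop
    refine measurable_pi_lambda _ fun i => ?_
    refine Fin.cases ?_ (fun j => ?_) i
    · simpa [knotheStep] using h1
    · simp only [knotheStep, Fin.cons_succ, Pi.smul_apply, smul_eq_mul]
      exact ((h1.pow_const 2).const_sub 1).sqrt.mul (measurable_pi_iff.1 h2 j)
  · have h1 := hX.sum_sq_le_one ((p.1, p.2 0), Fin.tail p.2)
    have h2 := hT (p.1, p.2 0)
    simp only at h2
    rw [Fin.sum_univ_succ]
    simp only [knotheStep, Fin.cons_zero, Fin.cons_succ, Pi.smul_apply, smul_eq_mul, mul_pow,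
      ← Finset.mul_sum]
    rw [Real.sq_sqrt (by linarith)]
    nlinarith
  · refine Fin.cases ?_ (fun j => ?_) i
    · simp only [knotheStep, Fin.cons_zero]
      refine monotone_ballQuantile n (monotone_firstCdf _ ?_)
      simpa using hh
    · have e1 : (x + h • (Pi.single j.succ 1 : Fin (n + 1) → ℝ)) 0 = x 0 := by simp
      have e2 : Fin.tail (x + h • (Pi.single j.succ 1 : Fin (n + 1) → ℝ)) =
          Fin.tail x + h • Pi.single j 1 := by
        ext k; simp [Fin.tail, Pi.single_apply]
      simp only [knotheStep, Fin.cons_succ, Pi.smul_apply, smul_eq_mul, e1, e2]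
      exact mul_le_mul_of_nonneg_left (hX.mono _ _ _ _ hh) (Real.sqrt_nonneg _)

theorem coordPartial_knotheStep_zero (E : Set (Y × (Fin (n + 1) → ℝ)))
    (X : (Y × ℝ) × (Fin n → ℝ) → Fin n → ℝ) (y : Y) (x : Fin (n + 1) → ℝ) :
    coordPartial (fun x => knotheStep E X (y, x)) 0 x =
      lowerDeriv (firstTransport (Prod.mk y ⁻¹' E)) (x 0) := by
  simp [coordPartial, lowerDeriv, knotheStep]

theorem coordPartial_knotheStep_succ (E : Set (Y × (Fin (n + 1) → ℝ)))
    (X : (Y × ℝ) × (Fin n → ℝ) → Fin n → ℝ) (y : Y) (t : ℝ) (z : Fin n → ℝ) (i : Fin n) :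
    coordPartial (fun x => knotheStep E X (y, x)) i.succ (Fin.cons t z) =
      ENNReal.ofReal √(1 - firstTransport (Prod.mk y ⁻¹' E) t ^ 2) *
        coordPartial (fun x => X ((y, t), x)) i z := by
  have e1 : ∀ h : ℝ, ((Fin.cons t z : Fin (n + 1) → ℝ) +
      h • (Pi.single i.succ 1 : Fin (n + 1) → ℝ)) 0 = t := by simp
  have e2 : ∀ h : ℝ, Fin.tail ((Fin.cons t z : Fin (n + 1) → ℝ) +
      h • (Pi.single i.succ 1 : Fin (n + 1) → ℝ)) = z + h • Pi.single i 1 := by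
    intro h; ext k; simp [Fin.tail, Pi.single_apply]
  simp only [coordPartial, lowerDeriv, knotheStep, e1, e2, Fin.cons_succ, Pi.smul_apply,
    smul_eq_mul]
  rw [← ENNReal.liminf_const_mul_of_ne_top ENNReal.ofReal_ne_top]
  congr 1; ext k
  rw [← ENNReal.ofReal_mul (Real.sqrt_nonneg _)]
  congr 1; ring

theorem lowerDeriv_firstTransport {S : Set (Fin (n + 1) → ℝ)} {t a : ℝ}
    (h : HasDerivAt (firstCdf S) a t) (ha : a ≠ 0) :
    lowerDeriv (firstTransport S) t =
      ENNReal.ofReal ((ballDensity n (firstTransport S t))⁻¹ * a) :=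
  lowerDeriv_eq_of_hasDerivAt
    ((hasDerivAt_ballQuantile (firstCdf_mem_Ioo_of_hasDerivAt h ha)).comp t h)

/-- Write κ for ball volumes, m for the slice volume and `r = √(1 - T²)`. The first factor is `T' =
(m/|S|) · κ_{n+1} / (rⁿ κ_n)`, the others contribute `rⁿ` and, by hypothesis on X, `κ_n / m`;
everything cancels to `κ_{n+1} / |S|`. -/
theorem prod_coordPartial_knotheStep [MeasurableSpace Y] {E : Set (Y × (Fin (n + 1) → ℝ))} (hE : MeasurableSet E)
    {X : (Y × ℝ) × (Fin n → ℝ) → Fin n → ℝ} (hX : IsMonotoneField X)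
    (hprod : ∀ p : Y × ℝ, volume (slice (Prod.mk p.1 ⁻¹' E) p.2) ≠ ⊤ →
      ∀ᵐ z, z ∈ slice (Prod.mk p.1 ⁻¹' E) p.2 →
      ∏ i, coordPartial (fun x => X (p, x)) i z =
        volume (coordBall n) / volume (slice (Prod.mk p.1 ⁻¹' E) p.2))
    (y : Y) (hy : volume (Prod.mk y ⁻¹' E) ≠ ⊤) :
    ∀ᵐ x, x ∈ Prod.mk y ⁻¹' E → ∏ i, coordPartial (fun x => knotheStep E X (y, x)) i x =
      volume (coordBall (n + 1)) / volume (Prod.mk y ⁻¹' E) := by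
  set S := Prod.mk y ⁻¹' E with hSdef
  have hS : MeasurableSet S := measurable_prodMk_left hE
  by_cases h0 : volume S = 0
  · filter_upwards [measure_eq_zero_iff_ae_notMem.1 h0] with x hx h using absurd h hx
  have hK := (isMonotoneField_knotheStep hE hX).measurable
  refine ae_of_ae_slice ?_ ?_
  · have hm : Measurable fun x => ∏ i, coordPartial (fun x => knotheStep E X (y, x)) i x := by
      refine Finset.measurable_prod _ fun i _ => ?_
      have h := (measurable_coordPartial hK i).comp (measurable_prodMk_left (x := y))
      simp only [Function.comp_def] at h
      exact h
    have : {x | x ∈ S → ∏ i, coordPartial (fun x => knotheStep E X (y, x)) i x =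
        volume (coordBall (n + 1)) / volume S} = Sᶜ ∪
        {x | ∏ i, coordPartial (fun x => knotheStep E X (y, x)) i x =
          volume (coordBall (n + 1)) / volume S} := by
      ext x; simp [imp_iff_not_or]
    rw [this]
    exact hS.compl.union (hm (measurableSet_singleton _))
  have hfin : ∀ᵐ t, volume (slice S t) < ⊤ := by
    refine ae_lt_top (measurable_volume_slice hS) ?_
    rwa [← volume_eq_lintegral_slice hS]
  filter_upwards [hfin, ae_hasDerivAt_firstCdf hS h0 hy] with t ht hd
  by_cases hm0 : volume (slice S t) = 0
  · filter_upwards [measure_eq_zero_iff_ae_notMem.1 hm0] with z hz h using absurd h hz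
  filter_upwards [hprod (y, t) ht.ne] with z hz hzS
  have hpz := hz hzS
  set m := volume (slice S t) with hm
  have ha : (m / volume S).toReal ≠ 0 :=
    (ENNReal.toReal_pos (ENNReal.div_ne_zero.2 ⟨hm0, hy⟩) (ENNReal.div_ne_top ht.ne h0)).ne'
  have hT : firstTransport S t ∈ Ioo (-1 : ℝ) 1 :=
    ballQuantile_mem_Ioo (firstCdf_mem_Ioo_of_hasDerivAt hd ha)
  set T := firstTransport S t with hTdef
  have hr : 0 < √(1 - T ^ 2) := Real.sqrt_pos.2 (by nlinarith [hT.1, hT.2])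
  rw [Fin.prod_univ_succ, coordPartial_knotheStep_zero]
  simp_rw [coordPartial_knotheStep_succ]
  rw [Finset.prod_mul_distrib, Fin.cons_zero, ← hSdef, lowerDeriv_firstTransport hd ha, ← hTdef,
    hpz, Finset.prod_const, Finset.card_univ, Fintype.card_fin, ballDensity]
  have hk := volume_coordBall_ne_zero n
  have hk' := volume_coordBall_ne_top n
  have hk1 := volume_coordBall_ne_zero (n + 1)
  have hk1' := volume_coordBall_ne_top (n + 1)
  have hm' := ht.ne
  rw [← ENNReal.ofReal_pow hr.le]
  have hk0 := ENNReal.toReal_pos hk hk'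
  have hk10 := ENNReal.toReal_pos hk1 hk1'
  have hS0 := ENNReal.toReal_pos h0 hy
  have hmm := ENNReal.toReal_pos hm0 hm'
  rw [← ENNReal.toReal_eq_toReal_iff' _ (ENNReal.div_ne_top hk1' h0)]
  · simp only [ENNReal.toReal_mul, ENNReal.toReal_div]
    rw [ENNReal.toReal_ofReal (by positivity), ENNReal.toReal_ofReal (by positivity)]
    field_simp
  · exact ENNReal.mul_ne_top ENNReal.ofReal_ne_top
      (ENNReal.mul_ne_top ENNReal.ofReal_ne_top (ENNReal.div_ne_top hk' hm0))

end Knothe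

/-- The parameter space is arbitrary so that the induction can absorb the first coordinate into it:
all slices are rearranged simultaneously, and measurably in their height. -/
theorem exists_knothe (n : ℕ) : ∀ (Y : Type) [MeasurableSpace Y] (E : Set (Y × (Fin n → ℝ))),
    MeasurableSet E → ∃ X : Y × (Fin n → ℝ) → Fin n → ℝ, IsMonotoneField X ∧
      ∀ y, volume (Prod.mk y ⁻¹' E) ≠ ⊤ → ∀ᵐ x, x ∈ Prod.mk y ⁻¹' E →
        ∏ i, coordPartial (fun x => X (y, x)) i x =
          volume (coordBall n) / volume (Prod.mk y ⁻¹' E) := by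
  induction n with
  | zero =>
    intro Y _ E hE
    refine ⟨fun _ => 0, ⟨measurable_const, by simp, by simp⟩, fun y _ => ae_of_all _ fun x hx => ?_⟩
    have h1 : Prod.mk y ⁻¹' E = univ := Subsingleton.eq_univ_of_nonempty ⟨x, hx⟩
    have h2 : coordBall 0 = univ := by ext; simp [coordBall]
    rw [h1, ← h2, ENNReal.div_self (volume_coordBall_ne_zero 0) (volume_coordBall_ne_top 0)]
    simp
  | succ n ih =>
    intro Y _ E hE
    have hE' : MeasurableSet {q : (Y × ℝ) × (Fin n → ℝ) |
        (q.1.1, (Fin.cons q.1.2 q.2 : Fin (n + 1) → ℝ)) ∈ E} := by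
      refine hE.preimage (Measurable.prodMk (by fun_prop) ?_)
      exact measurable_cons.comp (f := fun q : (Y × ℝ) × (Fin n → ℝ) => (q.1.2, q.2)) (by fun_prop)
    obtain ⟨X, hX, hprod⟩ := ih (Y × ℝ) _ hE'
    exact ⟨knotheStep E X, isMonotoneField_knotheStep hE hX,
      fun y hy => prod_coordPartial_knotheStep hE hX hprod y hy⟩

/-- A subset of Euclidean space in coordinates. -/
def coords {n : ℕ} (E : Set (EuclideanSpace ℝ (Fin n))) : Set (Fin n → ℝ) :=
  {x | WithLp.toLp 2 x ∈ E}

theorem measurableSet_coords {n : ℕ} {E : Set (EuclideanSpace ℝ (Fin n))} (hE : MeasurableSet E) :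
    MeasurableSet (coords E) :=
  hE.preimage (PiLp.volume_preserving_toLp (Fin n)).measurable

theorem volume_coords {n : ℕ} {E : Set (EuclideanSpace ℝ (Fin n))} (hE : MeasurableSet E) :
    volume (coords E) = volume E :=
  (PiLp.volume_preserving_toLp (Fin n)).measure_preimage hE.nullMeasurableSet

/-- The outermost Knothe step is written out, with a one-point parameter space, so that `a 0` is
known to be the derivative of the transport of first marginals; the equality case depends on this.
-/
theorem exists_knothe_euclidean {n : ℕ} {E : Set (EuclideanSpace ℝ (Fin (n + 1)))}
    (hE : MeasurableSet E) (hfin : volume E ≠ ⊤) :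
    ∃ a : Fin (n + 1) → EuclideanSpace ℝ (Fin (n + 1)) → ENNReal, (∀ i, Measurable (a i)) ∧
      (∀ x, a 0 x = lowerDeriv (firstTransport (coords E)) (x 0)) ∧
      ∫⁻ x in E, ∑ i, a i x ≤ perimeter E ∧
      ∀ᵐ x, x ∈ E → ∏ i, a i x = volume (coordBall (n + 1)) / volume E := by
  set S := coords E with hSdef
  have hS : MeasurableSet S := measurableSet_coords hE
  have hS' : MeasurableSet (Prod.snd ⁻¹' S : Set (Unit × (Fin (n + 1) → ℝ))) := measurable_snd hS
  have hslice : MeasurableSet {q : (Unit × ℝ) × (Fin n → ℝ) |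
      (Fin.cons q.1.2 q.2 : Fin (n + 1) → ℝ) ∈ S} := by
    refine hS.preimage ?_
    exact measurable_cons.comp (f := fun q : (Unit × ℝ) × (Fin n → ℝ) => (q.1.2, q.2)) (by fun_prop)
  obtain ⟨X', hX', hprod'⟩ := exists_knothe n (Unit × ℝ) _ hslice
  have hX := isMonotoneField_knotheStep hS' hX'
  have hprod := prod_coordPartial_knotheStep hS' hX' hprod' ()
    (by rw [show Prod.mk () ⁻¹' (Prod.snd ⁻¹' S) = S from rfl, volume_coords hE]; exact hfin)
  set X := knotheStep (Prod.snd ⁻¹' S) X' with hXdef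
  rw [show Prod.mk () ⁻¹' (Prod.snd ⁻¹' S) = S from rfl, volume_coords hE] at hprod
  let Z : EuclideanSpace ℝ (Fin (n + 1)) → EuclideanSpace ℝ (Fin (n + 1)) :=
    fun x => WithLp.toLp 2 (X ((), x.ofLp))
  have hZ : Measurable Z := by
    have h1 : Measurable fun x : EuclideanSpace ℝ (Fin (n + 1)) => X ((), x.ofLp) :=
      hX.measurable.comp (measurable_prodMk_left.comp
        (PiLp.volume_preserving_ofLp (Fin (n + 1))).measurable)
    exact (PiLp.volume_preserving_toLp (Fin (n + 1))).measurable.comp h1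
  have hZp : ∀ i x, lowerPartial Z i x = coordPartial (fun x => X ((), x)) i x.ofLp := by
    intro i x
    simp [lowerPartial, coordPartial, lowerDeriv, Z]
  refine ⟨lowerPartial Z, measurable_lowerPartial hZ, fun x => ?_, ?_, ?_⟩
  · rw [hZp, hXdef, coordPartial_knotheStep_zero]
    rfl
  · refine lintegral_sum_lowerPartial_le_perimeter hfin hZ (fun x => ?_) (fun i x h hh => ?_)
    · have := hX.sum_sq_le_one ((), x.ofLp)
      rw [← sq_le_one_iff₀ (norm_nonneg _), EuclideanSpace.real_norm_sq_eq]
      exact this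
    · simpa [Z] using hX.mono () x.ofLp i h hh
  · have h := (PiLp.volume_preserving_ofLp (Fin (n + 1))).quasiMeasurePreserving.ae hprod
    filter_upwards [h] with x hx hxE
    simp_rw [hZp]
    exact hx hxE

/-! ### AM-GM, the isoperimetric inequality and its first consequence of equality -/

theorem sum_ge_of_prod_eq {n : ℕ} {a : Fin (n + 1) → ENNReal} {c : ℝ} (hc : 0 < c)
    (h : ∏ i, a i = ENNReal.ofReal c) :
    ENNReal.ofReal ((n + 1) * c ^ ((n + 1 : ℝ)⁻¹)) ≤ ∑ i, a i ∧
    (∑ i, a i = ENNReal.ofReal ((n + 1) * c ^ ((n + 1 : ℝ)⁻¹)) →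
      a 0 = ENNReal.ofReal (c ^ ((n + 1 : ℝ)⁻¹))) := by
  have h0 : ∀ i, a i ≠ 0 := fun i hi => by
    have := Finset.prod_eq_zero (Finset.mem_univ i) hi
    rw [h, ENNReal.ofReal_eq_zero] at this
    linarith
  -- Since no factor vanishes, an infinite one would make the product infinite.
  have htop : ∀ i, a i ≠ ⊤ := fun i hi => by
    have h1 := Finset.mul_prod_erase Finset.univ a (Finset.mem_univ i)
    rw [h, hi, ENNReal.top_mul (Finset.prod_ne_zero_iff.2 fun j _ => h0 j)] at h1
    exact ENNReal.ofReal_ne_top h1.symm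
  set α : Fin (n + 1) → ℝ := fun i => (a i).toReal with hα
  have hα0 : ∀ i, 0 < α i := fun i => ENNReal.toReal_pos (h0 i) (htop i)
  have haα : ∀ i, a i = ENNReal.ofReal (α i) := fun i => (ENNReal.ofReal_toReal (htop i)).symm
  have hN : (0 : ℝ) < n + 1 := by positivity
  have hp : ∏ i, α i = c := by
    have := congrArg ENNReal.toReal h
    rwa [ENNReal.toReal_prod, ENNReal.toReal_ofReal hc.le] at this
  have hs : ∑ i, a i = ENNReal.ofReal (∑ i, α i) := by
    rw [ENNReal.ofReal_sum_of_nonneg fun i _ => (hα0 i).le]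
    exact Finset.sum_congr rfl fun i _ => haα i
  have hgeo : ∏ i, α i ^ ((n + 1 : ℝ)⁻¹) = c ^ ((n + 1 : ℝ)⁻¹) := by
    rw [Real.finsetProd_rpow _ _ fun i _ => (hα0 i).le, hp]
  have hw : ∑ _i : Fin (n + 1), ((n + 1 : ℝ)⁻¹) = 1 := by
    simp [hN.ne']
  have hsum : ∑ i, (n + 1 : ℝ)⁻¹ * α i = (n + 1 : ℝ)⁻¹ * ∑ i, α i := Finset.mul_sum .. |>.symm
  rw [hs]
  refine ⟨ENNReal.ofReal_le_ofReal ?_, fun heq => ?_⟩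
  · have := Real.geom_mean_le_arith_mean_weighted Finset.univ (fun _ => (n + 1 : ℝ)⁻¹) α
      (fun _ _ => by positivity) hw (fun i _ => (hα0 i).le)
    rw [hgeo, hsum, le_inv_mul_iff₀ hN] at this
    exact this
  · have hsum0 : 0 ≤ ∑ i, α i := Finset.sum_nonneg fun i _ => (hα0 i).le
    rw [ENNReal.ofReal_eq_ofReal_iff hsum0 (by positivity)] at heq
    have := (Real.geom_mean_eq_arith_mean_weighted_iff_of_pos Finset.univ
      (fun _ => (n + 1 : ℝ)⁻¹) α (fun _ _ => by positivity) hw (fun i _ => (hα0 i).le)).1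
      (by rw [hgeo, hsum, heq]; field_simp)
    have hall : ∀ j, α j = α 0 := fun j => this j (Finset.mem_univ j) 0 (Finset.mem_univ 0)
    rw [haα 0]
    congr 1
    have : ∑ i, α i = (n + 1) * α 0 := by
      rw [Finset.sum_congr rfl fun j _ => hall j]
      simp
    rw [this] at heq
    exact mul_left_cancel₀ hN.ne' heq

/-- The isoperimetric inequality at arbitrary finite positive volume. -/
theorem isoperimetric_inequality {n : ℕ} {E : Set (EuclideanSpace ℝ (Fin (n + 1)))}
    (hE : MeasurableSet E) (h0 : volume E ≠ 0) (hfin : volume E ≠ ⊤) :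
    ENNReal.ofReal ((n + 1) * ((volume (coordBall (n + 1)) / volume E).toReal) ^ ((n + 1 : ℝ)⁻¹)) *
      volume E ≤ perimeter E := by
  obtain ⟨a, ham, -, hle, hprod⟩ := exists_knothe_euclidean hE hfin
  have hr0 : volume (coordBall (n + 1)) / volume E ≠ 0 :=
    ENNReal.div_ne_zero.2 ⟨volume_coordBall_ne_zero _, hfin⟩
  have hr1 : volume (coordBall (n + 1)) / volume E ≠ ⊤ :=
    ENNReal.div_ne_top (volume_coordBall_ne_top _) h0
  refine le_trans ?_ hle
  rw [← setLIntegral_const]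
  refine setLIntegral_mono_ae (Finset.measurable_sum _ fun i _ => ham i).aemeasurable ?_
  filter_upwards [hprod] with x hx hxE
  exact (sum_ge_of_prod_eq (ENNReal.toReal_pos hr0 hr1)
    (by rw [hx hxE, ENNReal.ofReal_toReal hr1])).1

theorem mul_volume_ball_le_perimeter {n : ℕ} {E : Set (EuclideanSpace ℝ (Fin (n + 1)))}
    (hE : MeasurableSet E) (hvol : volume E = volume (coordBall (n + 1))) :
    (n + 1) * volume (coordBall (n + 1)) ≤ perimeter E := by
  have h := isoperimetric_inequality hE (hvol ▸ volume_coordBall_ne_zero _)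
    (hvol ▸ volume_coordBall_ne_top _)
  rw [hvol, ENNReal.div_self (volume_coordBall_ne_zero _) (volume_coordBall_ne_top _),
    ENNReal.toReal_one, Real.one_rpow, mul_one] at h
  convert h using 2
  rw [ENNReal.ofReal_add (by positivity) zero_le_one]
  simp

/-- In the equality case the first marginal of `E` satisfies the same differential equation as
that of the ball. -/
theorem ae_firstCdf_of_perimeter_le {n : ℕ} {E : Set (EuclideanSpace ℝ (Fin (n + 1)))}
    (hE : MeasurableSet E) (hvol : volume E = volume (coordBall (n + 1)))
    (hper : perimeter E ≤ (n + 1) * volume (coordBall (n + 1))) :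
    ∀ᵐ t, HasDerivAt (firstCdf (coords E))
      (volume (slice (coords E) t) / volume (coords E)).toReal t ∧
      ((volume (slice (coords E) t) / volume (coords E)).toReal ≠ 0 →
        (volume (slice (coords E) t) / volume (coords E)).toReal =
          ballDensity n (firstTransport (coords E) t)) := by
  obtain ⟨a, ham, ha0, hle, hprod⟩ := exists_knothe_euclidean hE
    (hvol ▸ volume_coordBall_ne_top _)
  have hS := measurableSet_coords hE
  have hSvol : volume (coords E) = volume (coordBall (n + 1)) := (volume_coords hE).trans hvol
  rw [hvol, ENNReal.div_self (volume_coordBall_ne_zero _) (volume_coordBall_ne_top _)] at hprod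
  have hge : ∀ᵐ x ∂volume.restrict E, ((n : ENNReal) + 1) ≤ ∑ i, a i x ∧
      (∑ i, a i x = n + 1 → a 0 x = 1) := by
    rw [ae_restrict_iff' hE]
    filter_upwards [hprod] with x hx hxE
    have := sum_ge_of_prod_eq one_pos ((hx hxE).trans ENNReal.ofReal_one.symm)
    rw [Real.one_rpow, mul_one, ENNReal.ofReal_add (by positivity) zero_le_one] at this
    simpa using this
  have hsm : Measurable fun x => ∑ i, a i x := Finset.measurable_sum _ fun i _ => ham i
  -- The sum is at least `n + 1` pointwise and its integral is at most `(n + 1)|E|`, so AM-GM is an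
  -- equality a.e. on E.
  have heq : (fun _ => (n : ENNReal) + 1) =ᵐ[volume.restrict E] fun x => ∑ i, a i x := by
    refine ae_eq_of_ae_le_of_lintegral_le (hge.mono fun x hx => hx.1) ?_ hsm.aemeasurable ?_
    · rw [setLIntegral_const, hvol]
      exact ENNReal.mul_ne_top (by simp) (volume_coordBall_ne_top _)
    · rw [setLIntegral_const, hvol]
      exact hle.trans hper
  have hone : ∀ᵐ x, x ∈ E → lowerDeriv (firstTransport (coords E)) (x 0) = 1 := by
    rw [← ae_restrict_iff' hE]
    filter_upwards [hge, heq] with x hx hx'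
    rw [← ha0]
    exact hx.2 hx'.symm
  have hTm : Measurable (firstTransport (coords E)) :=
    (monotone_ballQuantile n).measurable.comp (monotone_firstCdf _).measurable
  have hLm : Measurable (lowerDeriv (firstTransport (coords E))) := by
    unfold lowerDeriv
    refine Measurable.liminf fun k => ?_
    fun_prop
  set N : Set ℝ := {t | lowerDeriv (firstTransport (coords E)) t ≠ 1} with hN
  have hNm : MeasurableSet N := (hLm (measurableSet_singleton 1)).compl
  -- The condition depends on `x 0` only, so E has no mass over the bad heights and almost all their
  -- slices are null.
  have hnull : ∫⁻ t in N, volume (slice (coords E) t) = 0 := by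
    rw [← volume_inter_first_eq_setLIntegral hS hNm]
    have h := (PiLp.volume_preserving_toLp (Fin (n + 1))).quasiMeasurePreserving.ae hone
    refine measure_eq_zero_iff_ae_notMem.2 ?_
    filter_upwards [h] with x hx hxN
    exact hxN.2 (hx hxN.1)
  have hslice : ∀ᵐ t, t ∈ N → volume (slice (coords E) t) = 0 := by
    rw [lintegral_eq_zero_iff (measurable_volume_slice hS)] at hnull
    exact (ae_restrict_iff' hNm).1 hnull
  filter_upwards [hslice, ae_hasDerivAt_firstCdf hS (hSvol ▸ volume_coordBall_ne_zero _)
    (hSvol ▸ volume_coordBall_ne_top _)] with t ht hd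
  refine ⟨hd, fun hne => ?_⟩
  by_cases htN : t ∈ N
  · rw [ht htN] at hne; simp at hne
  · have h1 : lowerDeriv (firstTransport (coords E)) t = 1 := not_not.1 htN
    rw [lowerDeriv_firstTransport hd hne, ENNReal.ofReal_eq_one, inv_mul_eq_one₀] at h1
    · exact h1.symm
    · exact (ballDensity_pos n
        (ballQuantile_mem_Ioo (firstCdf_mem_Ioo_of_hasDerivAt hd hne))).ne'

/-! ### The perimeter of the unit ball -/

theorem hasCompactSupport_divergence {n : ℕ}
    {X : EuclideanSpace ℝ (Fin n) → EuclideanSpace ℝ (Fin n)} (hX : HasCompactSupport X) :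
    HasCompactSupport (divergence X) := by
  refine (hX.fderiv (𝕜 := ℝ)).mono fun x hx h0 => ?_
  simp [divergence, h0] at hx

theorem integrable_divergence {n : ℕ}
    {X : EuclideanSpace ℝ (Fin n) → EuclideanSpace ℝ (Fin n)} (hX : ContDiff ℝ ∞ X)
    (hXc : HasCompactSupport X) : Integrable (divergence X) :=
  (continuous_divergence hX).integrable_of_hasCompactSupport (hasCompactSupport_divergence hXc)

theorem sum_apply_single_mul {n : ℕ} (L : EuclideanSpace ℝ (Fin n) →L[ℝ] ℝ)
    (v : EuclideanSpace ℝ (Fin n)) : ∑ i, L (EuclideanSpace.single i 1) * v i = L v := by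
  conv_rhs => rw [← (EuclideanSpace.basisFun (Fin n) ℝ).sum_repr v]
  simp [mul_comm]

/-- Integration by parts holds for line derivatives of Lipschitz functions, coordinate by
coordinate; by Rademacher's theorem these assemble a.e. into the Fréchet derivative. -/
theorem integral_mul_divergence_eq {n : ℕ} {f : EuclideanSpace ℝ (Fin n) → ℝ} {C : NNReal}
    (hf : LipschitzWith C f) {X : EuclideanSpace ℝ (Fin n) → EuclideanSpace ℝ (Fin n)}
    (hX : ContDiff ℝ ∞ X) (hXc : HasCompactSupport X) :
    ∫ x, f x * divergence X x = -∫ x, fderiv ℝ f x (X x) := by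
  have hXi : ∀ i, ContDiff ℝ ∞ (fun x => X x i) := fun i =>
    (EuclideanSpace.proj (𝕜 := ℝ) i).contDiff.comp hX
  have hXic : ∀ i, HasCompactSupport (fun x => X x i) := fun i =>
    hXc.comp_left (g := fun y : EuclideanSpace ℝ (Fin n) => y i) rfl
  have hd : ∀ x i, lineDeriv ℝ (fun x => X x i) x (-EuclideanSpace.single i 1) =
      -fderiv ℝ X x (EuclideanSpace.single i 1) i := by
    intro x i
    have h1 : DifferentiableAt ℝ (fun x => X x i) x := (hXi i).differentiable (by simp) x
    rw [h1.lineDeriv_eq_fderiv, map_neg]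
    have h2 := ((EuclideanSpace.proj (𝕜 := ℝ) i).hasFDerivAt).comp x
      (hX.differentiable (by simp) x).hasFDerivAt
    have h3 : fderiv ℝ (fun x => X x i) x =
        (EuclideanSpace.proj (𝕜 := ℝ) i).comp (fderiv ℝ X x) := h2.fderiv
    rw [h3]; rfl
  have hparts : ∀ i : Fin n, ∫ x, lineDeriv ℝ f x (EuclideanSpace.single i 1) * X x i =
      -∫ x, f x * fderiv ℝ X x (EuclideanSpace.single i 1) i := by
    intro i
    obtain ⟨D, hD⟩ := ContDiff.lipschitzWith_of_hasCompactSupport (hXic i) (hXi i) (by simp)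
    rw [hf.integral_lineDeriv_mul_eq hD (hXic i), ← integral_neg]
    congr 1; ext x
    rw [hd]; ring
  have hint1 : ∀ i : Fin n, Integrable fun x => f x * fderiv ℝ X x (EuclideanSpace.single i 1) i := by
    intro i
    have hc : Continuous fun x => fderiv ℝ X x (EuclideanSpace.single i 1) i := by
      have := hX.continuous_fderiv (by simp)
      fun_prop
    refine (hf.continuous.mul hc).integrable_of_hasCompactSupport (HasCompactSupport.mul_left ?_)
    refine (hXc.fderiv (𝕜 := ℝ)).mono fun x hx h0 => ?_
    simp [h0] at hx
  have hint2 : ∀ i : Fin n, Integrable fun x => lineDeriv ℝ f x (EuclideanSpace.single i 1) * X x i := by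
    intro i
    refine Integrable.bdd_mul (c := C * ‖(EuclideanSpace.single i 1 : EuclideanSpace ℝ (Fin n))‖)
      ((hXi i).continuous.integrable_of_hasCompactSupport (hXic i))
      (measurable_lineDeriv hf.continuous).aestronglyMeasurable
      (ae_of_all _ fun x => norm_lineDeriv_le_of_lipschitz ℝ hf)
  have hsum : ∀ᵐ x, fderiv ℝ f x (X x) =
      ∑ i, lineDeriv ℝ f x (EuclideanSpace.single i 1) * X x i := by
    filter_upwards [hf.ae_differentiableAt (μ := volume)] with x hx
    simp_rw [hx.lineDeriv_eq_fderiv]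
    exact (sum_apply_single_mul _ _).symm
  rw [integral_congr_ae hsum, integral_finsetSum _ fun i _ => hint2 i]
  simp_rw [hparts, divergence, Finset.mul_sum]
  rw [integral_finsetSum _ fun i _ => hint1 i, Finset.sum_neg_distrib, neg_neg]

/-- A Lipschitz function equal to one on a ball and vanishing outside the unit ball. -/
noncomputable def radialCutoff (n k : ℕ) (x : EuclideanSpace ℝ (Fin n)) : ℝ :=
  max 0 (min 1 ((k + 1) * (1 - ‖x‖)))

theorem lipschitzWith_radialCutoff (n k : ℕ) : LipschitzWith (k + 1) (radialCutoff n k) := by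
  refine (LipschitzWith.const_min ?_ 1).const_max 0
  refine LipschitzWith.of_dist_le_mul fun x y => ?_
  rw [Real.dist_eq, ← mul_sub, abs_mul, abs_of_pos (by positivity), dist_eq_norm]
  push_cast
  gcongr
  rw [show 1 - ‖x‖ - (1 - ‖y‖) = -(‖x‖ - ‖y‖) by ring, abs_neg]
  exact abs_norm_sub_norm_le x y

theorem fderiv_radialCutoff_eq_zero {n k : ℕ} {x : EuclideanSpace ℝ (Fin n)}
    (hx : x ∉ Metric.closedBall 0 1 \ Metric.ball 0 (1 - (k + 1 : ℝ)⁻¹)) :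
    fderiv ℝ (radialCutoff n k) x = 0 := by
  have hk : (0 : ℝ) < k + 1 := by positivity
  by_cases h : x ∈ Metric.closedBall (0 : EuclideanSpace ℝ (Fin n)) 1
  · have hb : x ∈ Metric.ball (0 : EuclideanSpace ℝ (Fin n)) (1 - (k + 1 : ℝ)⁻¹) := by
      by_contra h'; exact hx ⟨h, h'⟩
    have : radialCutoff n k =ᶠ[𝓝 x] fun _ => 1 := by
      filter_upwards [Metric.isOpen_ball.mem_nhds hb] with y hy
      rw [mem_ball_zero_iff] at hy
      have : 1 ≤ (k + 1 : ℝ) * (1 - ‖y‖) := by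
        rw [← inv_le_iff_one_le_mul₀' hk]; linarith
      simp [radialCutoff, this]
    rw [this.fderiv_eq, fderiv_const_apply]
  · have : radialCutoff n k =ᶠ[𝓝 x] fun _ => 0 := by
      filter_upwards [Metric.isClosed_closedBall.isOpen_compl.mem_nhds h] with y hy
      have hy' : 1 < ‖y‖ := by simpa using hy
      have : (k + 1 : ℝ) * (1 - ‖y‖) ≤ 0 := mul_nonpos_of_nonneg_of_nonpos hk.le (by linarith)
      exact max_eq_left ((min_le_right _ _).trans this)
    rw [this.fderiv_eq, fderiv_const_apply]

/-- Bernoulli's inequality for `(1 - 1/(k+1))ⁿ`. -/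
theorem volume_shell_le (n k : ℕ) [Nonempty (Fin n)] :
    volume.real (Metric.closedBall (0 : EuclideanSpace ℝ (Fin n)) 1 \
      Metric.ball 0 (1 - (k + 1 : ℝ)⁻¹)) ≤
      n / (k + 1) * volume.real (Metric.ball (0 : EuclideanSpace ℝ (Fin n)) 1) := by
  have hk : (0 : ℝ) < k + 1 := by positivity
  have hr : 0 ≤ 1 - (k + 1 : ℝ)⁻¹ := by
    rw [sub_nonneg]; exact inv_le_one_of_one_le₀ (by linarith [(Nat.cast_nonneg k : (0:ℝ) ≤ k)])
  rw [measureReal_sdiff (Metric.ball_subset_closedBall.trans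
    (Metric.closedBall_subset_closedBall (by linarith [inv_pos.2 hk]))) measurableSet_ball measure_closedBall_lt_top.ne]
  rw [measureReal_def, measureReal_def, measureReal_def, Measure.addHaar_closedBall _ _ zero_le_one,
    Measure.addHaar_ball _ _ hr]
  simp only [finrank_euclideanSpace, Fintype.card_fin, one_pow, ENNReal.ofReal_one, one_mul,
    ENNReal.toReal_mul]
  rw [ENNReal.toReal_ofReal (by positivity)]
  have hb := one_add_mul_le_pow (a := -(k + 1 : ℝ)⁻¹) (by
    have := inv_le_one_of_one_le₀ (show (1 : ℝ) ≤ k + 1 by linarith [(Nat.cast_nonneg k : (0:ℝ) ≤ k)])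
    linarith) n
  have hv : 0 ≤ (volume (Metric.ball (0 : EuclideanSpace ℝ (Fin n)) 1)).toReal :=
    ENNReal.toReal_nonneg
  have e : (n : ℝ) / (k + 1) = 1 - (1 + n * -(k + 1 : ℝ)⁻¹) := by ring
  rw [e]
  rw [← sub_eq_add_neg] at hb
  nlinarith

/-- Replace the indicator of the ball by radial cutoffs: the gradient is at most `k + 1` and lives
on a shell of volume at most `n |B| / (k + 1)`, so the bound `n |B|` is uniform in k. -/
theorem perimeter_ball_le (n : ℕ) [Nonempty (Fin n)] :
    perimeter (Metric.ball (0 : EuclideanSpace ℝ (Fin n)) 1) ≤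
      n * volume (Metric.ball (0 : EuclideanSpace ℝ (Fin n)) 1) := by
  refine iSup₂_le fun X hX => ?_
  set B := Metric.ball (0 : EuclideanSpace ℝ (Fin n)) 1 with hB
  have hBfin : volume B ≠ ⊤ := measure_ball_lt_top.ne
  rw [← ENNReal.ofReal_toReal (ENNReal.mul_ne_top (ENNReal.natCast_ne_top n) hBfin)]
  apply ENNReal.ofReal_le_ofReal
  rw [ENNReal.toReal_mul, ENNReal.toReal_natCast]
  have hdc := continuous_divergence hX.contDiff
  have hdi := integrable_divergence hX.contDiff hX.hasCompactSupport
  have hbound : ∀ k : ℕ, ∫ x, radialCutoff n k x * divergence X x ≤ n * volume.real B := by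
    intro k
    have hlip := lipschitzWith_radialCutoff n k
    rw [integral_mul_divergence_eq hlip hX.contDiff hX.hasCompactSupport]
    set s := Metric.closedBall (0 : EuclideanSpace ℝ (Fin n)) 1 \
      Metric.ball 0 (1 - (k + 1 : ℝ)⁻¹) with hs
    have hsfin : volume s < ⊤ := (measure_mono sdiff_subset).trans_lt measure_closedBall_lt_top
    rw [← setIntegral_eq_integral_of_forall_compl_eq_zero (s := s)
      (fun x hx => by rw [fderiv_radialCutoff_eq_zero hx]; rfl)]
    refine (neg_le_abs _).trans ?_
    rw [← Real.norm_eq_abs]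
    have h1 : ‖∫ x in s, fderiv ℝ (radialCutoff n k) x (X x)‖ ≤ (k + 1) * volume.real s := by
      apply norm_setIntegral_le_of_norm_le_const hsfin
      intro x _
      calc _ ≤ ‖fderiv ℝ (radialCutoff n k) x‖ * ‖X x‖ := ContinuousLinearMap.le_opNorm _ _
        _ ≤ (k + 1) * 1 := by
            gcongr
            · simpa using norm_fderiv_le_of_lipschitz ℝ hlip
            · exact hX.norm_le_one x
        _ = _ := mul_one _
    refine h1.trans ?_
    calc (k + 1 : ℝ) * volume.real s ≤ (k + 1) * (n / (k + 1) * volume.real B) := by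
          gcongr; exact volume_shell_le n k
      _ = n * volume.real B := by field_simp
  have hlim : Tendsto (fun k : ℕ => ∫ x, radialCutoff n k x * divergence X x) atTop
      (𝓝 (∫ x, B.indicator (divergence X) x)) := by
    refine tendsto_integral_of_dominated_convergence (fun x => ‖divergence X x‖)
      (fun k => ((lipschitzWith_radialCutoff n k).continuous.mul hdc).aestronglyMeasurable)
      hdi.norm (fun k => ae_of_all _ fun x => ?_) (ae_of_all _ fun x => ?_)
    · rw [norm_mul]
      refine mul_le_of_le_one_left (norm_nonneg _) ?_
      rw [Real.norm_of_nonneg (show 0 ≤ radialCutoff n k x from le_max_left _ _)]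
      exact max_le zero_le_one (min_le_left _ _)
    · apply tendsto_const_nhds.congr'
      by_cases hx : ‖x‖ < 1
      · obtain ⟨N, hN⟩ := exists_nat_ge (1 - ‖x‖)⁻¹
        filter_upwards [eventually_ge_atTop N] with k hk
        have hk' : (N : ℝ) ≤ k := by exact_mod_cast hk
        have : 1 ≤ (k + 1 : ℝ) * (1 - ‖x‖) := by
          rw [← inv_le_iff_one_le_mul₀ (by linarith)]; linarith
        rw [indicator_of_mem (by simpa [hB] using hx)]
        simp [radialCutoff, this]
      · refine Eventually.of_forall fun k => ?_
        have : (k + 1 : ℝ) * (1 - ‖x‖) ≤ 0 :=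
          mul_nonpos_of_nonneg_of_nonpos (by positivity) (by linarith)
        have h0 : radialCutoff n k x = 0 := max_eq_left ((min_le_right _ _).trans this)
        rw [indicator_of_notMem (by simpa [hB] using hx)]
        simp [h0]
  rw [integral_indicator measurableSet_ball] at hlim
  exact le_of_tendsto' hlim hbound

/-! ### Cutting a set by a hyperplane -/

theorem deriv_smoothTransition_eq_zero {s : ℝ} (hs : s < 0 ∨ 1 < s) :
    deriv Real.smoothTransition s = 0 := by
  rcases hs with hs | hs
  · have : Real.smoothTransition =ᶠ[𝓝 s] fun _ => 0 := by
      filter_upwards [Iio_mem_nhds hs] with u hu using Real.smoothTransition.zero_of_nonpos hu.le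
    rw [this.deriv_eq, deriv_const]
  · have : Real.smoothTransition =ᶠ[𝓝 s] fun _ => 1 := by
      filter_upwards [Ioi_mem_nhds hs] with u hu using Real.smoothTransition.one_of_one_le hu.le
    rw [this.deriv_eq, deriv_const]

theorem exists_abs_deriv_smoothTransition_le :
    ∃ C : ℝ, ∀ s, |deriv Real.smoothTransition s| ≤ C := by
  have hc : Continuous (deriv Real.smoothTransition) :=
    (Real.smoothTransition.contDiff (n := 1)).continuous_deriv le_rfl
  obtain ⟨C, hC⟩ := (HasCompactSupport.intro (isCompact_Icc (a := (0 : ℝ)) (b := 1))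
    fun s hs => deriv_smoothTransition_eq_zero (by
      by_contra! h; exact hs h)).exists_bound_of_continuous hc
  exact ⟨C, hC⟩

section Cut

variable {n : ℕ}

/-- A smooth approximation of the indicator function of the half-space `0 < ε * (x 0 - t)`. -/
noncomputable def halfCutoff (ε t : ℝ) (k : ℕ) (x : EuclideanSpace ℝ (Fin (n + 1))) : ℝ :=
  Real.smoothTransition ((k + 1) * (ε * (x 0 - t)))

theorem contDiff_halfCutoff (ε t : ℝ) (k : ℕ) :
    ContDiff ℝ ∞ (halfCutoff ε t k : EuclideanSpace ℝ (Fin (n + 1)) → ℝ) := by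
  unfold halfCutoff
  have h0 : ContDiff ℝ ∞ fun x : EuclideanSpace ℝ (Fin (n + 1)) => x 0 :=
    (EuclideanSpace.proj (𝕜 := ℝ) (0 : Fin (n + 1))).contDiff
  exact Real.smoothTransition.contDiff.comp (by fun_prop)

theorem halfCutoff_mem_Icc (ε t : ℝ) (k : ℕ) (x : EuclideanSpace ℝ (Fin (n + 1))) :
    0 ≤ halfCutoff ε t k x ∧ halfCutoff ε t k x ≤ 1 :=
  ⟨Real.smoothTransition.nonneg _, Real.smoothTransition.le_one _⟩

theorem halfCutoff_eq_zero {ε t : ℝ} {k : ℕ} {x : EuclideanSpace ℝ (Fin (n + 1))}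
    (hx : ε * (x 0 - t) ≤ 0) : halfCutoff ε t k x = 0 :=
  Real.smoothTransition.zero_of_nonpos (mul_nonpos_of_nonneg_of_nonpos (by positivity) hx)

theorem fderiv_halfCutoff_apply (ε t : ℝ) (k : ℕ) (x v : EuclideanSpace ℝ (Fin (n + 1))) :
    fderiv ℝ (halfCutoff ε t k) x v =
      deriv Real.smoothTransition ((k + 1) * (ε * (x 0 - t))) * ((k + 1) * (ε * v 0)) := by
  have h1 : HasFDerivAt (fun x : EuclideanSpace ℝ (Fin (n + 1)) => (k + 1 : ℝ) * (ε * (x 0 - t)))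
      ((k + 1 : ℝ) • ε • (EuclideanSpace.proj (𝕜 := ℝ) (0 : Fin (n + 1)))) x :=
    (((EuclideanSpace.proj (𝕜 := ℝ) (0 : Fin (n + 1))).hasFDerivAt.sub_const t).const_mul
      ε).const_mul _
  have h2 : HasDerivAt Real.smoothTransition _ ((k + 1 : ℝ) * (ε * (x 0 - t))) :=
    ((Real.smoothTransition.contDiff (n := 1)).differentiable (by simp) _).hasDerivAt
  have h3 : fderiv ℝ (halfCutoff ε t k) x = _ := (h2.comp_hasFDerivAt x h1).fderiv
  rw [h3]
  simp

/-- The gradient of the cutoff is of order `k + 1` and vanishes outside the slab of half-width `1/(k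
+ 1)`, so `ht` says precisely that the flux through the cut disappears. The sign `ε` selects the
side. -/
theorem tendsto_integral_divergence_halfCutoff {E : Set (EuclideanSpace ℝ (Fin (n + 1)))}
    (hfin : volume E ≠ ⊤) {ε t : ℝ} (hε : |ε| = 1)
    (ht : Tendsto (fun k : ℕ => (k + 1 : ℝ) *
      volume.real (E ∩ {x | |x 0 - t| ≤ (k + 1 : ℝ)⁻¹})) atTop (𝓝 0))
    (hE : MeasurableSet E) {X : EuclideanSpace ℝ (Fin (n + 1)) → EuclideanSpace ℝ (Fin (n + 1))}
    (hX : IsTestField univ X) :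
    Tendsto (fun k : ℕ => ∫ x in E, divergence (fun y => halfCutoff ε t k y • X y) x) atTop
      (𝓝 (∫ x in E ∩ {x | 0 < ε * (x 0 - t)}, divergence X x)) := by
  have hdc := continuous_divergence hX.contDiff
  have hds := hasCompactSupport_divergence hX.hasCompactSupport
  have hdi := integrable_divergence hX.contDiff hX.hasCompactSupport
  have hd : ∀ k x, divergence (fun y => halfCutoff ε t k y • X y) x =
      halfCutoff ε t k x * divergence X x + fderiv ℝ (halfCutoff ε t k) x (X x) := fun k x =>
    divergence_smul ((contDiff_halfCutoff ε t k).differentiable (by simp) x)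
      (hX.contDiff.differentiable (by simp) x)
  have hi1 : ∀ k, Integrable (fun x => halfCutoff ε t k x * divergence X x) := fun k =>
    ((contDiff_halfCutoff ε t k).continuous.mul hdc).integrable_of_hasCompactSupport hds.mul_left
  have hi2 : ∀ k, Integrable (fun x => fderiv ℝ (halfCutoff ε t k) x (X x)) := fun k => by
    refine ((((contDiff_halfCutoff ε t k).continuous_fderiv (by simp)).clm_apply
      hX.contDiff.continuous)).integrable_of_hasCompactSupport (hX.hasCompactSupport.mono ?_)
    intro x hx h0
    simp [h0] at hx
  obtain ⟨C, hC⟩ := exists_abs_deriv_smoothTransition_le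
  have hmeas : Measurable fun x : EuclideanSpace ℝ (Fin (n + 1)) => x 0 :=
    (EuclideanSpace.proj (𝕜 := ℝ) (0 : Fin (n + 1))).continuous.measurable
  have herr : Tendsto (fun k => ∫ x in E, fderiv ℝ (halfCutoff ε t k) x (X x)) atTop (𝓝 0) := by
    refine squeeze_zero_norm (a := fun k : ℕ => C * ((k + 1 : ℝ) *
      volume.real (E ∩ {x | |x 0 - t| ≤ (k + 1 : ℝ)⁻¹}))) (fun k => ?_) (by simpa using ht.const_mul C)
    have hs : MeasurableSet {x : EuclideanSpace ℝ (Fin (n + 1)) | |x 0 - t| ≤ (k + 1 : ℝ)⁻¹} :=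
      measurableSet_le (by fun_prop) measurable_const
    have hk : (0 : ℝ) < k + 1 := by positivity
    rw [setIntegral_eq_of_subset_of_forall_sdiff_eq_zero hE inter_subset_left
      (t := E) (s := E ∩ {x | |x 0 - t| ≤ (k + 1 : ℝ)⁻¹})]
    · rw [← mul_assoc]
      refine norm_setIntegral_le_of_norm_le_const
        ((measure_mono inter_subset_left).trans_lt hfin.lt_top) fun x _ => ?_
      rw [fderiv_halfCutoff_apply, norm_mul, Real.norm_eq_abs, Real.norm_eq_abs, abs_mul, abs_mul,
        hε, one_mul, abs_of_pos hk]
      have h1 : |X x 0| ≤ 1 := by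
        simpa using (PiLp.norm_apply_le (X x) 0).trans (hX.norm_le_one x)
      have h0 : 0 ≤ C := (abs_nonneg _).trans (hC 0)
      calc _ ≤ C * ((k + 1 : ℝ) * 1) := by
            gcongr
            exact hC _
        _ = _ := by ring
    · intro x hx
      have hlt : (k + 1 : ℝ)⁻¹ < |x 0 - t| := by
        by_contra! h
        exact hx.2 ⟨hx.1, h⟩
      have h1 : 1 < |(k + 1 : ℝ) * (ε * (x 0 - t))| := by
        rw [abs_mul, abs_mul, hε, one_mul, abs_of_pos hk]
        rwa [inv_lt_iff_one_lt_mul₀' hk] at hlt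
      rw [fderiv_halfCutoff_apply, deriv_smoothTransition_eq_zero, zero_mul]
      rcases lt_abs.1 h1 with h | h
      · exact Or.inr h
      · left; linarith
  have hs : MeasurableSet {x : EuclideanSpace ℝ (Fin (n + 1)) | 0 < ε * (x 0 - t)} :=
    measurableSet_lt measurable_const (by fun_prop)
  have hmain : Tendsto (fun k => ∫ x in E, halfCutoff ε t k x * divergence X x) atTop
      (𝓝 (∫ x in E ∩ {x | 0 < ε * (x 0 - t)}, divergence X x)) := by
    rw [← setIntegral_indicator hs]
    refine tendsto_integral_of_dominated_convergence (fun x => ‖divergence X x‖)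
      (fun k => ((contDiff_halfCutoff ε t k).continuous.mul hdc).aestronglyMeasurable)
      hdi.norm.integrableOn (fun k => ae_of_all _ fun x => ?_) (ae_of_all _ fun x => ?_)
    · rw [norm_mul]
      refine mul_le_of_le_one_left (norm_nonneg _) ?_
      rw [Real.norm_of_nonneg (halfCutoff_mem_Icc ε t k x).1]
      exact (halfCutoff_mem_Icc ε t k x).2
    · apply tendsto_const_nhds.congr'
      by_cases hx : 0 < ε * (x 0 - t)
      · obtain ⟨N, hN⟩ := exists_nat_ge (ε * (x 0 - t))⁻¹
        filter_upwards [eventually_ge_atTop N] with k hk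
        have hk' : (N : ℝ) ≤ k := by exact_mod_cast hk
        have h1 : 1 ≤ (k + 1 : ℝ) * (ε * (x 0 - t)) := by
          rw [← inv_le_iff_one_le_mul₀ hx]; linarith
        rw [indicator_of_mem (by exact hx)]
        simp [halfCutoff, Real.smoothTransition.one_of_one_le h1]
      · refine Eventually.of_forall fun k => ?_
        rw [indicator_of_notMem (by exact hx)]
        simp [halfCutoff_eq_zero (not_lt.1 hx)]
  have := hmain.add herr
  rw [add_zero] at this
  refine this.congr fun k => ?_
  simp_rw [hd]
  rw [integral_add (hi1 k).integrableOn (hi2 k).integrableOn]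

theorem integral_divergence_add {m : ℕ}
    {X Y : EuclideanSpace ℝ (Fin m) → EuclideanSpace ℝ (Fin m)} (hX : ContDiff ℝ ∞ X)
    (hXc : HasCompactSupport X) (hY : ContDiff ℝ ∞ Y) (hYc : HasCompactSupport Y)
    (E : Set (EuclideanSpace ℝ (Fin m))) :
    (∫ x in E, divergence X x) + ∫ x in E, divergence Y x =
      ∫ x in E, divergence (fun y => X y + Y y) x := by
  rw [← integral_add (integrable_divergence hX hXc).integrableOn
    (integrable_divergence hY hYc).integrableOn]
  congr 1; ext x
  have := fderiv_fun_add (hX.differentiable (by simp) x) (hY.differentiable (by simp) x)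
  simp only [divergence, this, add_apply, PiLp.add_apply, Finset.sum_add_distrib]

theorem isTestField_zero (m : ℕ) : IsTestField univ
    (fun _ : EuclideanSpace ℝ (Fin m) => (0 : EuclideanSpace ℝ (Fin m))) :=
  ⟨contDiff_const, HasCompactSupport.zero, subset_univ _, by simp⟩

theorem exists_isTestField_max {m : ℕ} (E : Set (EuclideanSpace ℝ (Fin m)))
    {X : EuclideanSpace ℝ (Fin m) → EuclideanSpace ℝ (Fin m)} (hX : IsTestField univ X) :
    ∃ X', IsTestField univ X' ∧
      ∫ x in E, divergence X' x = max 0 (∫ x in E, divergence X x) := by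
  rcases le_total 0 (∫ x in E, divergence X x) with h | h
  · exact ⟨X, hX, (max_eq_right h).symm⟩
  · exact ⟨_, isTestField_zero m, by rw [max_eq_left h]; simp [divergence]⟩

/-- Nearly optimal fields for the two pieces, each cut off to its own side, add up to one competitor
for E, and the cut contributes nothing in the limit. -/
theorem perimeter_add_perimeter_le {E : Set (EuclideanSpace ℝ (Fin (n + 1)))}
    (hE : MeasurableSet E) (hfin : volume E ≠ ⊤) {t : ℝ}
    (ht : Tendsto (fun k : ℕ => (k + 1 : ℝ) *
      volume.real (E ∩ {x | |x 0 - t| ≤ (k + 1 : ℝ)⁻¹})) atTop (𝓝 0)) :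
    perimeter (E ∩ {x | x 0 < t}) + perimeter (E ∩ {x | t < x 0}) ≤ perimeter E := by
  have hminus : {x : EuclideanSpace ℝ (Fin (n + 1)) | x 0 < t} = {x | 0 < (-1 : ℝ) * (x 0 - t)} := by
    ext x; simp
  have hplus : {x : EuclideanSpace ℝ (Fin (n + 1)) | t < x 0} = {x | 0 < (1 : ℝ) * (x 0 - t)} := by
    ext x; simp
  rw [hminus, hplus]
  have key : ∀ X Y, IsTestField univ X → IsTestField univ Y →
      ENNReal.ofReal ((∫ x in E ∩ {x | 0 < (-1 : ℝ) * (x 0 - t)}, divergence X x) +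
        ∫ x in E ∩ {x | 0 < (1 : ℝ) * (x 0 - t)}, divergence Y x) ≤ perimeter E := by
    intro X Y hX hY
    have hlim := (tendsto_integral_divergence_halfCutoff hfin (ε := -1) (by simp) ht hE hX).add
      (tendsto_integral_divergence_halfCutoff hfin (ε := 1) (by simp) ht hE hY)
    refine le_of_tendsto' (ENNReal.tendsto_ofReal hlim) fun k => ?_
    have hA : ContDiff ℝ ∞ fun y => halfCutoff (-1) t k y • X y :=
      (contDiff_halfCutoff _ _ _).smul hX.contDiff
    have hB : ContDiff ℝ ∞ fun y => halfCutoff 1 t k y • Y y :=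
      (contDiff_halfCutoff _ _ _).smul hY.contDiff
    have hAc : HasCompactSupport fun y => halfCutoff (-1) t k y • X y :=
      hX.hasCompactSupport.mono fun y hy h0 => hy (by simp only [h0, smul_zero])
    have hBc : HasCompactSupport fun y => halfCutoff 1 t k y • Y y :=
      hY.hasCompactSupport.mono fun y hy h0 => hy (by simp only [h0, smul_zero])
    rw [integral_divergence_add hA hAc hB hBc]
    refine le_perimeter_of_isTestField E ⟨hA.add hB, hAc.add hBc, subset_univ _, fun x => ?_⟩
    have hle : ∀ {ε : ℝ} {Z : EuclideanSpace ℝ (Fin (n + 1)) → EuclideanSpace ℝ (Fin (n + 1))},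
        IsTestField univ Z → ‖halfCutoff ε t k x • Z x‖ ≤ 1 := fun hZ => by
      rw [norm_smul, Real.norm_of_nonneg (halfCutoff_mem_Icc _ t k x).1]
      exact mul_le_one₀ (halfCutoff_mem_Icc _ t k x).2 (norm_nonneg _) (hZ.norm_le_one x)
    -- At each point at most one of the two cut-off fields is nonzero, so the sum keeps length at
    -- most 1.
    rcases le_total (x 0) t with h | h
    · rw [halfCutoff_eq_zero (ε := 1) (by linarith), zero_smul, add_zero]
      exact hle hX
    · rw [halfCutoff_eq_zero (ε := -1) (by linarith), zero_smul, zero_add]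
      exact hle hY
  refine ENNReal.biSup_add_biSup_le' ⟨_, isTestField_zero _⟩ ⟨_, isTestField_zero _⟩
    fun X hX Y hY => ?_
  -- `ENNReal.ofReal` is additive only on nonnegative reals, so a field with negative integral is
  -- first exchanged for zero.
  obtain ⟨X', hX', hXe⟩ := exists_isTestField_max (E ∩ {x | 0 < (-1 : ℝ) * (x 0 - t)}) hX
  obtain ⟨Y', hY', hYe⟩ := exists_isTestField_max (E ∩ {x | 0 < (1 : ℝ) * (x 0 - t)}) hY
  have := key X' Y' hX' hY'
  rw [hXe, hYe, ENNReal.ofReal_add (le_max_left _ _) (le_max_left _ _)] at this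
  refine le_trans (add_le_add ?_ ?_) this <;> exact ENNReal.ofReal_le_ofReal (le_max_right _ _)

end Cut

/-! ### Equality case: the first marginal is a translate of that of the ball -/

section Marginal

variable {n : ℕ} {E : Set (EuclideanSpace ℝ (Fin (n + 1)))}

theorem volume_inter_coord (hE : MeasurableSet E) {A : Set ℝ} (hA : MeasurableSet A) :
    volume (E ∩ {x | x 0 ∈ A}) = volume (coords E ∩ {x | x 0 ∈ A}) := by
  have hm : MeasurableSet {x : EuclideanSpace ℝ (Fin (n + 1)) | x 0 ∈ A} :=
    (EuclideanSpace.proj (𝕜 := ℝ) (0 : Fin (n + 1))).continuous.measurable hA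
  rw [← volume_coords (hE.inter hm)]
  rfl

theorem volume_inter_coord_eq_zero (hE : MeasurableSet E) (t : ℝ) :
    volume (E ∩ {x | x 0 = t}) = 0 := by
  have := volume_inter_coord hE (measurableSet_singleton t)
  rw [volume_inter_first_eq_setLIntegral (measurableSet_coords hE) (measurableSet_singleton t)] at this
  simpa using this

theorem volume_inter_coord_le (hE : MeasurableSet E) (h0 : volume E ≠ 0) (hfin : volume E ≠ ⊤)
    (t : ℝ) : volume (E ∩ {x | x 0 ≤ t}) = ENNReal.ofReal (firstCdf (coords E) t) * volume E := by
  have h := volume_inter_coord hE (measurableSet_Iic (a := t))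
  rw [firstCdf, ENNReal.ofReal_toReal
    (ne_top_of_le_ne_top ENNReal.one_ne_top (firstCdf_ratio_le_one _ t)), volume_coords hE,
    ENNReal.div_mul_cancel h0 hfin, ← h]
  rfl

theorem real_volume_inter_coord_Ioc (hE : MeasurableSet E) (h0 : volume E ≠ 0)
    (hfin : volume E ≠ ⊤) {s t : ℝ} (hst : s ≤ t) :
    volume.real (E ∩ {x | x 0 ∈ Ioc s t}) =
      (firstCdf (coords E) t - firstCdf (coords E) s) * volume.real E := by
  have h0' : volume (coords E) ≠ 0 := by rwa [volume_coords hE]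
  have hfin' : volume (coords E) ≠ ⊤ := by rwa [volume_coords hE]
  have := isProbabilityMeasure_firstMarginal h0' hfin'
  rw [firstCdf_eq_cdf, cdf_sub_cdf hst, measureReal_def, measureReal_def, measureReal_def,
    firstMarginal_apply _ measurableSet_Ioc, volume_inter_coord hE measurableSet_Ioc,
    ← ENNReal.toReal_mul, ← volume_coords hE, ENNReal.div_mul_cancel h0' hfin']

theorem tendsto_volume_slab_of_hasDerivAt (hE : MeasurableSet E) (h0 : volume E ≠ 0)
    (hfin : volume E ≠ ⊤) {t : ℝ} (hd : HasDerivAt (firstCdf (coords E)) 0 t) :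
    Tendsto (fun k : ℕ => (k + 1 : ℝ) *
      volume.real (E ∩ {x | |x 0 - t| ≤ (k + 1 : ℝ)⁻¹})) atTop (𝓝 0) := by
  set F := firstCdf (coords E) with hF
  have hs := hasDerivAt_iff_tendsto_slope_zero.1 hd
  have h1 := hs.comp tendsto_inv_natCast_add_one
  -- The factor 2 makes the half-open interval contain the left endpoint of the closed slab.
  have h2' : Tendsto (fun k : ℕ => -2 * ((k + 1 : ℝ))⁻¹) atTop (𝓝[≠] 0) := by
    have hk := tendsto_nhdsWithin_iff.1 tendsto_inv_natCast_add_one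
    refine tendsto_nhdsWithin_iff.2 ⟨by simpa using hk.1.const_mul (-2), ?_⟩
    filter_upwards [hk.2] with k hk' using mul_ne_zero (by norm_num) hk'
  have h2 := hs.comp h2'
  have h3 : Tendsto (fun k : ℕ => ((k + 1 : ℝ) * (F (t + (k + 1 : ℝ)⁻¹) - F (t + -2 * (k + 1 : ℝ)⁻¹))) *
      volume.real E) atTop (𝓝 0) := by
    have := (h1.add (h2.const_mul 2)).mul_const (volume.real E)
    simp only [smul_eq_mul, mul_zero, add_zero, zero_mul] at this
    refine this.congr fun k => ?_
    have : (k + 1 : ℝ) ≠ 0 := by positivity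
    simp only [Function.comp_apply]
    field_simp
    ring
  refine squeeze_zero (fun k => by positivity) (fun k => ?_) h3
  have hk : (0 : ℝ) < (k + 1 : ℝ)⁻¹ := by positivity
  rw [mul_assoc, ← real_volume_inter_coord_Ioc hE h0 hfin (by linarith)]
  refine mul_le_mul_of_nonneg_left (measureReal_mono ?_ ?_) (by positivity)
  · rintro x ⟨hx, hx'⟩
    have := abs_le.1 hx'.out
    exact ⟨hx, by constructor <;> linarith [this.1, this.2]⟩
  · exact ne_top_of_le_ne_top hfin (measure_mono inter_subset_left)

/-- The constant in the isoperimetric inequality carries the factor `(|B|/|E|)^(1/(n+1)) > 1`. -/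
theorem lt_perimeter_of_volume_lt (hE : MeasurableSet E) (h0 : volume E ≠ 0)
    (hlt : volume E < volume (coordBall (n + 1))) :
    (n + 1) * volume E < perimeter E := by
  have hfin := hlt.ne_top
  refine lt_of_lt_of_le ?_ (isoperimetric_inequality hE h0 hfin)
  rw [ENNReal.mul_lt_mul_iff_left h0 hfin]
  rw [show (n : ENNReal) + 1 = ENNReal.ofReal (n + 1) by
    rw [ENNReal.ofReal_add (by positivity) zero_le_one]; simp]
  rw [ENNReal.ofReal_lt_ofReal_iff_of_nonneg (by positivity)]
  have h1 : 1 < (volume (coordBall (n + 1)) / volume E).toReal := by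
    rw [ENNReal.toReal_div, one_lt_div (ENNReal.toReal_pos h0 hfin)]
    exact (ENNReal.toReal_lt_toReal hfin (volume_coordBall_ne_top _)).2 hlt
  have h2 := Real.one_lt_rpow h1 (z := (n + 1 : ℝ)⁻¹) (by positivity)
  nlinarith [(Nat.cast_nonneg n : (0 : ℝ) ≤ n)]

/-- This excludes gaps. A cut at such a height costs no perimeter, but splits E into two pieces of
positive, strictly smaller volume; adding their strict bounds contradicts `hper`. -/
theorem firstCdf_notMem_Ioo_of_hasDerivAt_zero (hE : MeasurableSet E)
    (hvol : volume E = volume (coordBall (n + 1)))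
    (hper : perimeter E ≤ (n + 1) * volume (coordBall (n + 1))) {t : ℝ}
    (hd : HasDerivAt (firstCdf (coords E)) 0 t) : firstCdf (coords E) t ∉ Ioo (0 : ℝ) 1 := by
  intro hF
  have h0 : volume E ≠ 0 := hvol ▸ volume_coordBall_ne_zero _
  have hfin : volume E ≠ ⊤ := hvol ▸ volume_coordBall_ne_top _
  have hcut := perimeter_add_perimeter_le hE hfin
    (tendsto_volume_slab_of_hasDerivAt hE h0 hfin hd)
  have hc : Measurable fun x : EuclideanSpace ℝ (Fin (n + 1)) => x 0 :=
    (EuclideanSpace.proj (𝕜 := ℝ) (0 : Fin (n + 1))).continuous.measurable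
  have hm1 : MeasurableSet {x : EuclideanSpace ℝ (Fin (n + 1)) | x 0 < t} :=
    measurableSet_lt hc measurable_const
  have hm2 : MeasurableSet {x : EuclideanSpace ℝ (Fin (n + 1)) | t < x 0} :=
    measurableSet_lt measurable_const hc
  have hle : volume (E ∩ {x | x 0 ≤ t}) = volume (E ∩ {x | x 0 < t}) := by
    refine le_antisymm ?_ (measure_mono (inter_subset_inter_right _ fun x (hx : x 0 < t) => hx.le))
    calc volume (E ∩ {x | x 0 ≤ t}) ≤ volume ((E ∩ {x | x 0 < t}) ∪ (E ∩ {x | x 0 = t})) := by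
          refine measure_mono fun x hx => ?_
          rcases lt_or_eq_of_le hx.2.out with h | h
          · exact Or.inl ⟨hx.1, h⟩
          · exact Or.inr ⟨hx.1, h⟩
      _ ≤ _ := measure_union_le _ _
      _ = _ := by rw [volume_inter_coord_eq_zero hE, add_zero]
  have hsplit : volume (E ∩ {x | x 0 < t}) + volume (E ∩ {x | t < x 0}) = volume E := by
    rw [← hle, ← measure_union _ (hE.inter hm2)]
    · congr 1; ext x
      simp only [mem_union, mem_inter_iff, mem_ofPred_eq]
      constructor
      · rintro (h | h) <;> exact h.1
      · intro h
        rcases le_or_gt (x 0) t with h' | h'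
        · exact Or.inl ⟨h, h'⟩
        · exact Or.inr ⟨h, h'⟩
    · exact Set.disjoint_left.2 fun x hx hx' => absurd hx.2.out (not_le.2 hx'.2.out)
  have hv1 : volume (E ∩ {x | x 0 < t}) = ENNReal.ofReal (firstCdf (coords E) t) * volume E :=
    hle ▸ volume_inter_coord_le hE h0 hfin t
  have hv10 : volume (E ∩ {x | x 0 < t}) ≠ 0 := by
    rw [hv1]
    exact mul_ne_zero (by simpa using hF.1) h0
  have hv1lt : volume (E ∩ {x | x 0 < t}) < volume E := by
    rw [hv1]
    conv_rhs => rw [← one_mul (volume E)]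
    rw [ENNReal.mul_lt_mul_iff_left h0 hfin, ENNReal.ofReal_lt_one]
    exact hF.2
  have hv20 : volume (E ∩ {x | t < x 0}) ≠ 0 := fun h => by
    rw [h, add_zero] at hsplit
    exact hv1lt.ne hsplit
  have hv2lt : volume (E ∩ {x | t < x 0}) < volume E := by
    calc _ < volume (E ∩ {x | t < x 0}) + volume (E ∩ {x | x 0 < t}) := ENNReal.lt_add_right
          (ne_top_of_le_ne_top hfin (measure_mono inter_subset_left)) hv10
      _ = _ := (add_comm _ _).trans hsplit
  have hp1 := lt_perimeter_of_volume_lt (hE.inter hm1) hv10 (hvol ▸ hv1lt)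
  have hp2 := lt_perimeter_of_volume_lt (hE.inter hm2) hv20 (hvol ▸ hv2lt)
  have := ENNReal.add_lt_add hp1 hp2
  rw [← mul_add, hsplit, hvol] at this
  exact absurd (hcut.trans hper) (not_le.2 this)

theorem isProbabilityMeasure_firstMarginal_coords (hE : MeasurableSet E)
    (hvol : volume E = volume (coordBall (n + 1))) :
    IsProbabilityMeasure (firstMarginal (coords E)) := by
  apply isProbabilityMeasure_firstMarginal <;> rw [volume_coords hE, hvol]
  exacts [volume_coordBall_ne_zero _, volume_coordBall_ne_top _]

theorem continuous_firstCdf_coords (hE : MeasurableSet E)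
    (hvol : volume E = volume (coordBall (n + 1))) : Continuous (firstCdf (coords E)) := by
  have := isProbabilityMeasure_firstMarginal_coords hE hvol
  rw [firstCdf_eq_cdf]
  exact continuous_cdf_firstMarginal (measurableSet_coords hE)

/-- In the absence of gaps the a.e. equation F' = f(T), with f the ball density, holds near t with a
continuous right-hand side, so it holds everywhere there; the chain rule then gives T' = 1. -/
theorem hasDerivAt_firstTransport_one (hE : MeasurableSet E)
    (hvol : volume E = volume (coordBall (n + 1)))
    (hper : perimeter E ≤ (n + 1) * volume (coordBall (n + 1))) {t : ℝ} (ht : firstCdf (coords E) t ∈ Ioo (0 : ℝ) 1) :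
    HasDerivAt (firstTransport (coords E)) 1 t := by
  have hprob := isProbabilityMeasure_firstMarginal_coords hE hvol
  have hcont := continuous_firstCdf_coords hE hvol
  have hnhds : firstCdf (coords E) ⁻¹' Ioo 0 1 ∈ 𝓝 t :=
    (isOpen_Ioo.preimage hcont).mem_nhds ht
  obtain ⟨a, b, htab, hab⟩ := mem_nhds_iff_exists_Ioo_subset.1 hnhds
  have hT : ContinuousOn (firstTransport (coords E)) (Ioo a b) := fun s hs =>
    ((continuousAt_ballQuantile (hab hs)).comp hcont.continuousAt).continuousWithinAt
  have hd : HasDerivAt (firstCdf (coords E)) (ballDensity n (firstTransport (coords E) t)) t := by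
    have h := hasDerivAt_cdf_of_continuousOn
      (firstMarginal_eq_withDensity (measurableSet_coords hE)) htab
      (g := fun s => ballDensity n (firstTransport (coords E) s))
      ((continuous_ballDensity n).comp_continuousOn hT)
      (fun s hs => (ballDensity_pos n (ballQuantile_mem_Ioo (hab hs))).le) ?_
    · rwa [← firstCdf_eq_cdf] at h
    · filter_upwards [ae_firstCdf_of_perimeter_le hE hvol hper] with s hs hsab
      have hne : (volume (slice (coords E) s) / volume (coords E)).toReal ≠ 0 := fun h => by
        refine firstCdf_notMem_Ioo_of_hasDerivAt_zero hE hvol hper ?_ (hab hsab)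
        rw [← h]; exact hs.1
      rw [← hs.2 hne, ENNReal.ofReal_toReal]
      exact fun htop => hne (by rw [htop]; rfl)
  have h := (hasDerivAt_ballQuantile (n := n) ht).comp t hd
  have hpos := ballDensity_pos n (ballQuantile_mem_Ioo (n := n) ht)
  rw [show (ballDensity n (ballQuantile n (firstCdf (coords E) t)))⁻¹ *
    ballDensity n (firstTransport (coords E) t) = 1 from inv_mul_cancel₀ hpos.ne'] at h
  exact h

theorem exists_firstTransport_eq_add (hE : MeasurableSet E)
    (hvol : volume E = volume (coordBall (n + 1)))
    (hper : perimeter E ≤ (n + 1) * volume (coordBall (n + 1))) : ∃ c : ℝ, ∀ t, firstCdf (coords E) t ∈ Ioo (0 : ℝ) 1 →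
    firstTransport (coords E) t = t + c := by
  have hcont := continuous_firstCdf_coords hE hvol
  have hopen : IsOpen (firstCdf (coords E) ⁻¹' Ioo 0 1) := isOpen_Ioo.preimage hcont
  have hconn : IsPreconnected (firstCdf (coords E) ⁻¹' Ioo 0 1) :=
    (ordConnected_Ioo.preimage_mono (monotone_firstCdf _)).isPreconnected
  have hder : ∀ t ∈ firstCdf (coords E) ⁻¹' Ioo 0 1,
      HasDerivAt (fun t => firstTransport (coords E) t - t) 0 t := fun t ht => by
    have h := (hasDerivAt_firstTransport_one hE hvol hper ht).sub (hasDerivAt_id t)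
    rw [sub_self] at h
    exact h
  obtain ⟨c, hc⟩ := hopen.exists_is_const_of_deriv_eq_zero hconn
    (fun t ht => (hder t ht).differentiableAt.differentiableWithinAt) (fun t ht => (hder t ht).deriv)
  exact ⟨c, fun t ht => by linarith [hc t ht]⟩

/-- Where `0 < F < 1` this is the translation property of T. At the other heights it follows from
monotonicity, since F attains every value in (0, 1). -/
theorem exists_firstCdf_eq_ballCdf (hE : MeasurableSet E)
    (hvol : volume E = volume (coordBall (n + 1)))
    (hper : perimeter E ≤ (n + 1) * volume (coordBall (n + 1))) :
    ∃ c : ℝ, ∀ t, firstCdf (coords E) t = ballCdf n (t + c) := by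
  have hprob := isProbabilityMeasure_firstMarginal_coords hE hvol
  have hcont := continuous_firstCdf_coords hE hvol
  obtain ⟨c, hc⟩ := exists_firstTransport_eq_add hE hvol hper
  have hin : ∀ t, firstCdf (coords E) t ∈ Ioo (0 : ℝ) 1 →
      firstCdf (coords E) t = ballCdf n (t + c) := fun t ht => by
    rw [← hc t ht, firstTransport, ballCdf_ballQuantile (Ioo_subset_Icc_self ht)]
  have hsurj : ∀ q ∈ Ioo (0 : ℝ) 1, ∃ u, firstCdf (coords E) u = q := by
    intro q hq
    have hbot : Tendsto (firstCdf (coords E)) atBot (𝓝 0) :=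
      firstCdf_eq_cdf (S := coords E) ▸ tendsto_cdf_atBot _
    have htop : Tendsto (firstCdf (coords E)) atTop (𝓝 1) :=
      firstCdf_eq_cdf (S := coords E) ▸ tendsto_cdf_atTop _
    exact mem_range_of_exists_le_of_exists_ge hcont
      ((hbot.eventually_lt_const hq.1).exists.imp fun _ h => h.le)
      ((htop.eventually_const_lt hq.2).exists.imp fun _ h => h.le)
  refine ⟨c, fun t => ?_⟩
  have hb0 : 0 ≤ ballCdf n (t + c) := cdf_nonneg _ _
  have hb1 : ballCdf n (t + c) ≤ 1 := cdf_le_one _ _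
  rcases eq_or_lt_of_le (firstCdf_mem_Icc (coords E) t).1 with h0 | h0
  · by_contra hne
    have hpos : 0 < ballCdf n (t + c) := lt_of_le_of_ne hb0 (h0 ▸ hne)
    -- F takes this intermediate value at some u, where it agrees with the translated ball function;
    -- then u ≤ t although F(u) > 0 = F(t). The case F(t) = 1 below is symmetric.
    have hq : ballCdf n (t + c) / 2 ∈ Ioo (0 : ℝ) 1 := ⟨by linarith, by linarith⟩
    obtain ⟨u, hu⟩ := hsurj _ hq
    have hu' := hin u (hu ▸ hq)
    have hut : u ≤ t := by
      by_contra! h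
      have := monotone_ballCdf n (show t + c ≤ u + c by linarith)
      linarith
    have := monotone_firstCdf (coords E) hut
    linarith
  · rcases eq_or_lt_of_le (firstCdf_mem_Icc (coords E) t).2 with h1 | h1
    · by_contra hne
      have hlt : ballCdf n (t + c) < 1 := lt_of_le_of_ne hb1 fun h => hne (h1.trans h.symm)
      have hq : (ballCdf n (t + c) + 1) / 2 ∈ Ioo (0 : ℝ) 1 := ⟨by linarith, by linarith⟩
      obtain ⟨u, hu⟩ := hsurj _ hq
      have hu' := hin u (hu ▸ hq)
      have hut : t ≤ u := by
        by_contra! h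
        have := monotone_ballCdf n (show u + c ≤ t + c by linarith)
        linarith
      have := monotone_firstCdf (coords E) hut
      linarith
    · exact hin t ⟨h0, h1⟩

theorem exists_map_coord_eq (hE : MeasurableSet E)
    (hvol : volume E = volume (coordBall (n + 1)))
    (hper : perimeter E ≤ (n + 1) * volume (coordBall (n + 1))) : ∃ c : ℝ, (volume.restrict E).map (fun x => x 0) =
    (volume.restrict (Metric.ball (0 : EuclideanSpace ℝ (Fin (n + 1))) 1)).map
      (fun x => x 0 - c) := by
  obtain ⟨c, hc⟩ := exists_firstCdf_eq_ballCdf hE hvol hper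
  have hm : Measurable fun x : EuclideanSpace ℝ (Fin (n + 1)) => x 0 :=
    (EuclideanSpace.proj (𝕜 := ℝ) (0 : Fin (n + 1))).continuous.measurable
  have hcb : coords (Metric.ball (0 : EuclideanSpace ℝ (Fin (n + 1))) 1) = coordBall (n + 1) := by
    rw [← ofLp_preimage_coordBall]; rfl
  have h0 : volume E ≠ 0 := hvol ▸ volume_coordBall_ne_zero _
  have hfin : volume E ≠ ⊤ := hvol ▸ volume_coordBall_ne_top _
  have : IsFiniteMeasure (volume.restrict E) := ⟨by simpa using hfin.lt_top⟩
  have : IsFiniteMeasure ((volume.restrict E).map (fun x => x 0)) :=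
    Measure.isFiniteMeasure_map _ _
  refine ⟨c, Measure.ext_of_Iic _ _ fun t => ?_⟩
  rw [Measure.map_apply hm measurableSet_Iic, Measure.map_apply (hm.sub_const c) measurableSet_Iic,
    Measure.restrict_apply (hm measurableSet_Iic),
    Measure.restrict_apply ((hm.sub_const c) measurableSet_Iic), inter_comm,
    inter_comm (_ ⁻¹' _)]
  have e1 : E ∩ (fun x => x 0) ⁻¹' Iic t = E ∩ {x | x 0 ≤ t} := rfl
  have e2 : Metric.ball (0 : EuclideanSpace ℝ (Fin (n + 1))) 1 ∩ (fun x => x 0 - c) ⁻¹' Iic t =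
      Metric.ball 0 1 ∩ {x | x 0 ≤ t + c} := by
    ext x; simp
  rw [e1, e2, volume_inter_coord_le hE h0 hfin, volume_inter_coord_le measurableSet_ball
    (volume_coordBall (n + 1) ▸ volume_coordBall_ne_zero _)
    (volume_coordBall (n + 1) ▸ volume_coordBall_ne_top _), hvol, ← volume_coordBall, hcb, hc t,
    firstCdf_eq_cdf]
  rfl

end Marginal

/-! ### Invariance under linear isometries and marginals in all directions -/

theorem divergence_eq_trace {n : ℕ} (X : EuclideanSpace ℝ (Fin n) → EuclideanSpace ℝ (Fin n))
    (x : EuclideanSpace ℝ (Fin n)) :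
    divergence X x = LinearMap.trace ℝ _ (fderiv ℝ X x : EuclideanSpace ℝ (Fin n) →ₗ[ℝ] _) := by
  rw [LinearMap.trace_eq_sum_inner _ (EuclideanSpace.basisFun (Fin n) ℝ)]
  simp [divergence, EuclideanSpace.inner_single_left]

/-- The divergence is the trace of the derivative, and the trace is invariant under conjugation. -/
theorem divergence_conj {n : ℕ} {X : EuclideanSpace ℝ (Fin n) → EuclideanSpace ℝ (Fin n)}
    (hX : Differentiable ℝ X) (L : EuclideanSpace ℝ (Fin n) ≃ₗᵢ[ℝ] EuclideanSpace ℝ (Fin n))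
    (x : EuclideanSpace ℝ (Fin n)) :
    divergence (fun y => L (X (L.symm y))) (L x) = divergence X x := by
  have h1 : HasFDerivAt (fun y => L (X (L.symm y)))
      ((L.toContinuousLinearEquiv : EuclideanSpace ℝ (Fin n) →L[ℝ] _).comp
        ((fderiv ℝ X x).comp (L.symm.toContinuousLinearEquiv : EuclideanSpace ℝ (Fin n) →L[ℝ] _)))
      (L x) := by
    refine (L.toContinuousLinearEquiv.hasFDerivAt).comp (L x) (HasFDerivAt.comp (L x) ?_
      (L.symm.toContinuousLinearEquiv.hasFDerivAt))
    change HasFDerivAt X _ (L.symm (L x))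
    rw [L.symm_apply_apply]
    exact (hX x).hasFDerivAt
  rw [divergence_eq_trace, divergence_eq_trace, h1.fderiv]
  exact LinearMap.trace_conj' (fderiv ℝ X x : EuclideanSpace ℝ (Fin n) →ₗ[ℝ] _) L.toLinearEquiv

theorem perimeter_preimage_le {n : ℕ} (E : Set (EuclideanSpace ℝ (Fin n)))
    (L : EuclideanSpace ℝ (Fin n) ≃ₗᵢ[ℝ] EuclideanSpace ℝ (Fin n)) :
    perimeter (L ⁻¹' E) ≤ perimeter E := by
  refine iSup₂_le fun X hX => ?_
  have hY : IsTestField univ (fun y => L (X (L.symm y))) := by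
    refine ⟨L.contDiff.comp (hX.contDiff.comp L.symm.contDiff), ?_, subset_univ _, fun y => ?_⟩
    · exact (hX.hasCompactSupport.comp_homeomorph L.symm.toHomeomorph).comp_left (map_zero L)
    · rw [L.norm_map]; exact hX.norm_le_one _
  refine le_trans (le_of_eq ?_) (le_perimeter_of_isTestField E hY)
  congr 1
  rw [← L.measurePreserving.setIntegral_preimage_emb L.toHomeomorph.measurableEmbedding
    (divergence fun y => L (X (L.symm y))) E]
  simp_rw [divergence_conj (hX.contDiff.differentiable (by simp)) L]

theorem perimeter_congr_preimage {n : ℕ} (E : Set (EuclideanSpace ℝ (Fin n)))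
    (L : EuclideanSpace ℝ (Fin n) ≃ₗᵢ[ℝ] EuclideanSpace ℝ (Fin n)) :
    perimeter (L ⁻¹' E) = perimeter E := by
  refine le_antisymm (perimeter_preimage_le E L) ?_
  conv_lhs => rw [show E = L.symm ⁻¹' (L ⁻¹' E) by ext; simp]
  exact perimeter_preimage_le _ L.symm

/-- A reflection takes `e` to the first basis vector and preserves volume, perimeter and the ball.
-/
theorem exists_map_inner_eq {n : ℕ} {E : Set (EuclideanSpace ℝ (Fin (n + 1)))}
    (hE : MeasurableSet E) (hvol : volume E = volume (coordBall (n + 1)))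
    (hper : perimeter E ≤ (n + 1) * volume (coordBall (n + 1)))
    {e : EuclideanSpace ℝ (Fin (n + 1))} (he : ‖e‖ = 1) :
    ∃ c : ℝ, (volume.restrict E).map (fun x => ⟪e, x⟫_ℝ) =
      (volume.restrict (Metric.ball (0 : EuclideanSpace ℝ (Fin (n + 1))) 1)).map
        (fun x => ⟪e, x⟫_ℝ - c) := by
  set e₀ : EuclideanSpace ℝ (Fin (n + 1)) := EuclideanSpace.single 0 1 with he₀
  have hn : ‖e‖ = ‖e₀‖ := by simp [he, he₀]
  obtain ⟨L, hL⟩ : ∃ L : EuclideanSpace ℝ (Fin (n + 1)) ≃ₗᵢ[ℝ] EuclideanSpace ℝ (Fin (n + 1)),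
      L e = e₀ := ⟨_, Submodule.reflection_sub hn⟩
  have hinner : ∀ x, ⟪e, x⟫_ℝ = (L x) 0 := fun x => by
    rw [← L.inner_map_map, hL, he₀, EuclideanSpace.inner_single_left]
    simp
  have hmp : MeasurePreserving L := L.measurePreserving
  have hE' : MeasurableSet (L.symm ⁻¹' E) := L.symm.continuous.measurable hE
  have hvol' : volume (L.symm ⁻¹' E) = volume (coordBall (n + 1)) := by
    rw [← hvol]; exact L.symm.measurePreserving.measure_preimage hE.nullMeasurableSet
  obtain ⟨c, hc⟩ := exists_map_coord_eq hE' hvol' (by rwa [perimeter_congr_preimage])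
  have hm : Measurable fun x : EuclideanSpace ℝ (Fin (n + 1)) => x 0 :=
    (EuclideanSpace.proj (𝕜 := ℝ) (0 : Fin (n + 1))).continuous.measurable
  have hmap : ∀ {A : Set (EuclideanSpace ℝ (Fin (n + 1)))}, MeasurableSet A →
      (volume.restrict (L ⁻¹' A)).map L = volume.restrict A := fun hA =>
    (hmp.restrict_preimage hA).map_eq
  refine ⟨c, ?_⟩
  simp_rw [hinner]
  have h1 : (volume.restrict E).map (fun x => (L x) 0) =
      (volume.restrict (L.symm ⁻¹' E)).map (fun x => x 0) := by
    rw [← hmap hE', Measure.map_map hm L.continuous.measurable]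
    congr 2
    ext; simp
  have h2 : (volume.restrict (Metric.ball (0 : EuclideanSpace ℝ (Fin (n + 1))) 1)).map
      (fun x => (L x) 0 - c) = (volume.restrict
        (Metric.ball (0 : EuclideanSpace ℝ (Fin (n + 1))) 1)).map (fun x => x 0 - c) := by
    conv_rhs => rw [← hmap measurableSet_ball, Measure.map_map (hm.sub_const c)
      L.continuous.measurable]
    congr 2
    ext x; simp
  rw [h1, h2, hc]

/-! ### Recovering the ball from its marginals -/

theorem setIntegral_ball_inner_eq_zero {n : ℕ} (e : EuclideanSpace ℝ (Fin n)) :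
    ∫ x in Metric.ball (0 : EuclideanSpace ℝ (Fin n)) 1, ⟪e, x⟫_ℝ = 0 := by
  rw [← integral_indicator measurableSet_ball]
  set g := (Metric.ball (0 : EuclideanSpace ℝ (Fin n)) 1).indicator fun x => ⟪e, x⟫_ℝ with hg
  have h : ∀ x, g (-x) = -g x := fun x => by
    by_cases hx : ‖x‖ < 1
    · rw [hg, indicator_of_mem (by simpa using hx), indicator_of_mem (by simpa using hx),
        inner_neg_right]
    · rw [hg, indicator_of_notMem (by simpa using hx), indicator_of_notMem (by simpa using hx),
        neg_zero]
  have h1 := integral_neg_eq_self g volume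
  simp_rw [h, integral_neg] at h1
  linarith

theorem integrableOn_ball_inner_sub {n : ℕ} (e : EuclideanSpace ℝ (Fin n)) (c : ℝ) :
    IntegrableOn (fun x => ⟪e, x⟫_ℝ - c) (Metric.ball (0 : EuclideanSpace ℝ (Fin n)) 1) :=
  ((by fun_prop : Continuous fun x : EuclideanSpace ℝ (Fin n) => ⟪e, x⟫_ℝ - c).continuousOn.integrableOn_compact
    (isCompact_closedBall 0 1)).mono_set Metric.ball_subset_closedBall

/-- Equality in the isoperimetric inequality forces `E` to be a ball. -/
theorem exists_restrict_eq_ball {n : ℕ} {E : Set (EuclideanSpace ℝ (Fin (n + 1)))}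
    (hE : MeasurableSet E) (hvol : volume E = volume (coordBall (n + 1)))
    (hper : perimeter E ≤ (n + 1) * volume (coordBall (n + 1))) :
    ∃ p, volume.restrict E = volume.restrict (Metric.ball p 1) := by
  have hfin : volume E ≠ ⊤ := hvol ▸ volume_coordBall_ne_top _
  set κ : ℝ := volume.real E with hκ
  have hκ0 : 0 < κ := ENNReal.toReal_pos (hvol ▸ volume_coordBall_ne_zero _) hfin
  set B := Metric.ball (0 : EuclideanSpace ℝ (Fin (n + 1))) 1 with hB
  have hBκ : volume.real B = κ := by
    rw [hκ, measureReal_def, measureReal_def, hvol, ← volume_coordBall]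
  have hBfin : volume B ≠ ⊤ := measure_ball_lt_top.ne
  have key := fun (e : EuclideanSpace ℝ (Fin (n + 1))) (he : ‖e‖ = 1) =>
    exists_map_inner_eq hE hvol hper he
  have hmi : ∀ e : EuclideanSpace ℝ (Fin (n + 1)), Measurable fun x => ⟪e, x⟫_ℝ := fun e => by
    fun_prop
  -- E is not known to be bounded; integrability is read off from its marginal, which is that of a
  -- bounded function on the ball.
  have hint : ∀ e : EuclideanSpace ℝ (Fin (n + 1)), ‖e‖ = 1 →
      IntegrableOn (fun x => ⟪e, x⟫_ℝ) E := by
    intro e he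
    obtain ⟨c, hc⟩ := key e he
    have h2 : Integrable id ((volume.restrict B).map (fun x => ⟪e, x⟫_ℝ - c)) :=
      (integrable_map_measure aestronglyMeasurable_id ((hmi e).sub_const c).aemeasurable).2
        (integrableOn_ball_inner_sub e c)
    rw [← hc] at h2
    exact (integrable_map_measure aestronglyMeasurable_id (hmi e).aemeasurable).1 h2
  have hcoord : ∀ i : Fin (n + 1), IntegrableOn (fun x : EuclideanSpace ℝ (Fin (n + 1)) => x i) E := by
    intro i
    have := hint (EuclideanSpace.single i 1) (by simp)
    simpa [EuclideanSpace.inner_single_left] using this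
  -- The barycentre of E. Since the ball has barycentre 0, comparing means shows that the shift in
  -- each direction `e` is `⟪e, p⟫`.
  let p : EuclideanSpace ℝ (Fin (n + 1)) := WithLp.toLp 2 fun i => κ⁻¹ * ∫ x in E, x i
  have hp : ∀ e : EuclideanSpace ℝ (Fin (n + 1)), ∫ x in E, ⟪e, x⟫_ℝ = κ * ⟪e, p⟫_ℝ := by
    intro e
    simp only [PiLp.inner_apply, RCLike.inner_apply, conj_trivial, p]
    rw [integral_finsetSum _ fun i _ => (hcoord i).mul_const _, Finset.mul_sum]
    refine Finset.sum_congr rfl fun i _ => ?_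
    rw [integral_mul_const]
    field_simp
  have hmap : ∀ e : EuclideanSpace ℝ (Fin (n + 1)), ‖e‖ = 1 →
      (volume.restrict E).map (fun x => ⟪e, x⟫_ℝ) =
        (volume.restrict B).map (fun x => ⟪e, x⟫_ℝ + ⟪e, p⟫_ℝ) := by
    intro e he
    obtain ⟨c, hc⟩ := key e he
    have h1 : ∫ x in E, ⟪e, x⟫_ℝ = ∫ x in B, (⟪e, x⟫_ℝ - c) := by
      have : ∫ s, s ∂((volume.restrict E).map (fun x => ⟪e, x⟫_ℝ)) =
        ∫ s, s ∂((volume.restrict B).map (fun x => ⟪e, x⟫_ℝ - c)) := by rw [hc]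
      rwa [integral_map (hmi e).aemeasurable (by fun_prop),
        integral_map ((hmi e).sub_const c).aemeasurable (by fun_prop)] at this
    have h2 : ∫ x in B, (⟪e, x⟫_ℝ - c) = -(κ * c) := by
      have hi : IntegrableOn (fun x => ⟪e, x⟫_ℝ) B := by
        simpa using integrableOn_ball_inner_sub e 0
      rw [integral_sub hi (integrableOn_const hBfin), setIntegral_ball_inner_eq_zero,
        setIntegral_const, hBκ]
      simp
    rw [hp, h2] at h1
    have : c = -⟪e, p⟫_ℝ := by
      have : κ * (c + ⟪e, p⟫_ℝ) = 0 := by linarith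
      rcases mul_eq_zero.1 this with h | h
      · exact absurd h hκ0.ne'
      · linarith
    rw [hc, this]
    simp_rw [sub_neg_eq_add]
    rfl
  refine ⟨p, ?_⟩
  have hshift : (volume.restrict B).map (fun x => x + p) = volume.restrict (Metric.ball p 1) := by
    have h := ((measurePreserving_add_right (volume : Measure (EuclideanSpace ℝ (Fin (n + 1)))) p)
      |>.restrict_preimage (measurableSet_ball (x := p) (ε := 1))).map_eq
    have hpre : (fun x => x + p) ⁻¹' Metric.ball p 1 = B := by
      ext x; simp [hB, dist_eq_norm]
    rwa [hpre] at h
  have hfE : IsFiniteMeasure (volume.restrict E) := ⟨by simpa using hfin.lt_top⟩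
  have hfB : IsFiniteMeasure (volume.restrict (Metric.ball p 1)) :=
    ⟨by simpa using measure_ball_lt_top⟩
  -- Cramér-Wold: the characteristic function at ξ depends only on the marginal in the direction of
  -- ξ.
  refine Measure.ext_of_charFun (funext fun ξ => ?_)
  by_cases hξ : ξ = 0
  · rw [hξ, charFun_zero, charFun_zero, measureReal_restrict_apply MeasurableSet.univ,
      measureReal_restrict_apply MeasurableSet.univ, univ_inter, univ_inter, ← hκ, ← hBκ,
      measureReal_def, measureReal_def, Measure.addHaar_ball_center volume p 1]
  have hnξ : ‖ξ‖ ≠ 0 := norm_ne_zero_iff.2 hξ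
  set e := ‖ξ‖⁻¹ • ξ with he
  have he1 : ‖e‖ = 1 := by rw [he, norm_smul, norm_inv, norm_norm, inv_mul_cancel₀ hnξ]
  have hξe : ξ = ‖ξ‖ • e := by rw [he, smul_smul, mul_inv_cancel₀ hnξ, one_smul]
  have hin : ∀ x, ⟪x, ξ⟫_ℝ = ‖ξ‖ * ⟪e, x⟫_ℝ := fun x => by
    conv_lhs => rw [hξe]
    rw [inner_smul_right, real_inner_comm]
  let h : ℝ → ℂ := fun s => Complex.exp ((‖ξ‖ * s : ℝ) * Complex.I)
  have hhc : Continuous h := by fun_prop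
  have hE1 : charFun (volume.restrict E) ξ = ∫ s, h s ∂((volume.restrict E).map
      (fun x => ⟪e, x⟫_ℝ)) := by
    rw [integral_map (hmi e).aemeasurable hhc.aestronglyMeasurable, charFun_apply]
    simp_rw [hin, h]
  have hB1 : charFun (volume.restrict (Metric.ball p 1)) ξ = ∫ s, h s ∂((volume.restrict B).map
      (fun x => ⟪e, x⟫_ℝ + ⟪e, p⟫_ℝ)) := by
    rw [integral_map ((hmi e).add_const _).aemeasurable hhc.aestronglyMeasurable, charFun_apply,
      ← hshift, integral_map (by fun_prop) (by fun_prop)]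
    simp_rw [hin, h, inner_add_right]
  rw [hE1, hB1, hmap e he1]

theorem symmDiff_null_of_restrict_eq {α : Type*} [MeasurableSpace α] {μ : Measure α} {A B : Set α}
    (hA : MeasurableSet A) (hB : MeasurableSet B) (h : μ.restrict A = μ.restrict B) :
    μ (symmDiff A B) = 0 := by
  rw [measure_symmDiff_eq hA.nullMeasurableSet hB.nullMeasurableSet]
  have h1 : μ (A \ B) = 0 := by
    have := congrArg (fun ν => ν Bᶜ) h
    simp only [Measure.restrict_apply hB.compl] at this
    rwa [compl_inter_self, measure_empty, inter_comm] at this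
  have h2 : μ (B \ A) = 0 := by
    have := congrArg (fun ν => ν Aᶜ) h
    simp only [Measure.restrict_apply hA.compl] at this
    rw [compl_inter_self, measure_empty, inter_comm] at this
    exact this.symm
  rw [h1, h2, add_zero]

theorem mainTheorem10 (n : ℕ) (E : Set (EuclideanSpace ℝ (Fin n)))
    (hE : HasFinitePerimeter E)
    (hvol : volume E = volume (Metric.ball (0 : EuclideanSpace ℝ (Fin n)) 1)) :
    perimeter (Metric.ball (0 : EuclideanSpace ℝ (Fin n)) 1) ≤ perimeter E ∧
      (perimeter E = perimeter (Metric.ball (0 : EuclideanSpace ℝ (Fin n)) 1) →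
        ∃ p : EuclideanSpace ℝ (Fin n), volume (symmDiff E (Metric.ball p 1)) = 0) := by
  have hEm := hE.measurableSet
  rcases n with _ | n
  -- In dimension zero the space is one point, and a set of positive measure is everything.
  · have hB : Metric.ball (0 : EuclideanSpace ℝ (Fin 0)) 1 = univ :=
      Subsingleton.eq_univ_of_nonempty ⟨0, by simp⟩
    have hEu : E = univ := by
      refine Subsingleton.eq_univ_of_nonempty (nonempty_iff_ne_empty.2 fun h => ?_)
      rw [h, measure_empty] at hvol
      exact (Metric.measure_ball_pos volume (0 : EuclideanSpace ℝ (Fin 0)) one_pos).ne hvol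
    rw [hB, hEu]
    exact ⟨le_rfl, fun _ => ⟨0, by rw [hB]; simp⟩⟩
  · rw [← volume_coordBall] at hvol
    have hball := perimeter_ball_le (n + 1)
    rw [← volume_coordBall, Nat.cast_add, Nat.cast_one] at hball
    refine ⟨hball.trans (mul_volume_ball_le_perimeter hEm hvol), fun heq => ?_⟩
    obtain ⟨p, hp⟩ := exists_restrict_eq_ball hEm hvol (heq.trans_le hball)
    exact ⟨p, symmDiff_null_of_restrict_eq hEm measurableSet_ball hp⟩
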